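/- Let $\Bbbk$ be an algebraically closed field and let $A$ be a finite-dimensional associative unital $\Bbbk$-algebra. Then $A$ has, up to isomorphism, only finitely many simple right modules. Let $M_1,\dots,M_r$ be representatives of their isomorphism classes and put $M=\bigoplus_{i=1}^r M_i$, with structure maps $\eta_{M_i}:A\to\operatorname{End}_\Bbbk(M_i)$ (endomorphisms act on the right). *Definitions.* An algebra augmented over $\Bbbk^r$ is a $\Bbbk$-algebra $S$ with algebra homomorphisms $\Bbbk^r\to S\xrightarrow{\pi_S}\Bbbk^r$ whose composite is the identity; morphisms commute with these maps. $S$ is complete if $S\to\varprojlim_n S/(\ker\pi_S)^n$ is bijective. A morphism $\psi:S\to S'$ induces, by extension of scalars, a homomorphism $\Pi(\psi):\operatorname{End}_S(S\otimes_{\Bbbk^r}M)\to\operatorname{End}_{S'}(S'\otimes_{\Bbbk^r}M)$. A family over $S$ is an algebra homomorphism $\phi:A\to\operatorname{End}_S(S\otimes_{\Bbbk^r}M)$ with $\Pi(\pi_S)\circ\phi=\bigoplus_i\eta_{M_i}$; two families over $S$ are isomorphic if they are conjugate by a unit $g$ of $\operatorname{End}_S(S\otimes_{\Bbbk^r}M)$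 with $\Pi(\pi_S)(g)=1$. Let $T=\Bbbk^r\oplus V$ be the $r\times r$ tangent algebra: $V$ is the $\Bbbk^r$-bimodule of all $r\times r$ matrices over $\Bbbk$, and $V\cdot V=0$. A pre-completion of $A$ in $M$ is a complete algebra $\hat H$ augmented over $\Bbbk^r$ together with a family $\rho$ over $\hat H$ such that for every complete augmented $S$ and every family $\phi$ over $S$ there is a morphism $\psi:\hat H\to S$ with $\Pi(\psi)\circ\rho$ isomorphic to $\phi$, and $\psi$ is unique if $S\cong T$. The ring of local functions $O^A(\operatorname{simp}A)=O^A_M$ at the set $\operatorname{simp}A=\{M_1,\dots,M_r\}$ is the subalgebra of $\operatorname{End}_{\hat H}(\hat H\otimes_{\Bbbk^r}M)$ generated by the image of $\Bbbk^r$, by $\rho(A)$, and by $\rho(a)^{-1}$ for all $a\in A$ such that $\rho(a)$ is a unit. *Claim.* A pre-completion of $A$ in $M$ exists, and for every pre-completion $(\hat H,\rho)$ of $A$ in $M$ the homomorphism $\eta:A\to O^A(\operatorname{simp}A)$, $a\mapsto\rho(a)$, is an isomorphism. -/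

import Mathlib

open scoped TensorProduct

universe u v w w'

namespace LocalFunctions

/-- A `k`-algebra augmented over `k^r`: a `k`-algebra with algebra homomorphisms
`k^r → H → k^r` whose composite is the identity. The image of `k^r` need not be central. -/
structure AugAlg (k : Type u) [Field k] (r : ℕ) where
  carrier : Type w
  [ring : Ring carrier]
  [algebra : Algebra k carrier]
  unit : (Fin r → k) →ₐ[k] carrier
  aug : carrier →ₐ[k] (Fin r → k)
  aug_unit : ∀ c, aug (unit c) = c

attribute [instance] AugAlg.ring AugAlg.algebra

namespace AugAlg

variable {k : Type u} [Field k] {r : ℕ}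

/-- Morphisms of augmented algebras: they commute with the maps from `k^r` and to `k^r`. -/
@[ext]
structure Hom (H : AugAlg.{u, w} k r) (S : AugAlg.{u, w'} k r) where
  toAlgHom : H.carrier →ₐ[k] S.carrier
  map_unit : ∀ c, toAlgHom (H.unit c) = S.unit c
  map_aug : ∀ x, S.aug (toAlgHom x) = H.aug x

/-- `H` and `S` are isomorphic as augmented algebras. -/
def IsIso (H : AugAlg.{u, w} k r) (S : AugAlg.{u, w'} k r) : Prop :=
  ∃ f : Hom H S, Function.Bijective f.toAlgHom

/-- The algebra `k^r`, augmented over itself. -/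
def base (k : Type u) [Field k] (r : ℕ) : AugAlg.{u, u} k r where
  carrier := Fin r → k
  unit := AlgHom.id k _
  aug := AlgHom.id k _
  aug_unit _ := rfl

/-- The augmentation as a morphism `H → k^r` of augmented algebras. -/
def augHom (H : AugAlg.{u, w} k r) : Hom H (base k r) where
  toAlgHom := H.aug
  map_unit := H.aug_unit
  map_aug _ := rfl

/-- The augmentation ideal (a two-sided ideal). -/
def augIdeal (H : AugAlg.{u, w} k r) : Ideal H.carrier := RingHom.ker H.aug

/-- `H` is complete: the natural map from `H` to the inverse limit of the `H / 𝔪 ^ n`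
is bijective, that is, each compatible sequence of residue classes comes from exactly one
element. -/
def IsComplete (H : AugAlg.{u, w} k r) : Prop :=
  ∀ s : ℕ → H.carrier, (∀ n, s (n + 1) - s n ∈ H.augIdeal ^ n) →
    ∃! x : H.carrier, ∀ n, x - s n ∈ H.augIdeal ^ n

/-- The carrier of the `r × r` tangent algebra: matrices `diag c + ε X` over the dual numbers,
with `c` in `k^r` and `X` an arbitrary `r × r` matrix over `k`. This is `T(V) / (ker π)²` for
the `k^r`-bimodule `V` with all `V i j = k`. -/
def tangentSubalgebra (k : Type u) [Field k] (r : ℕ) :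
    Subalgebra k (Matrix (Fin r) (Fin r) (DualNumber k)) where
  carrier := {X | ∀ i j, i ≠ j → TrivSqZeroExt.fst (X i j) = 0}
  mul_mem' := by
    intro X Y hX hY i j hij
    rw [Matrix.mul_apply, TrivSqZeroExt.fst_sum]
    refine Finset.sum_eq_zero fun l _ => ?_
    rw [TrivSqZeroExt.fst_mul]
    by_cases h : i = l
    · rw [hY l j (h ▸ hij), mul_zero]
    · rw [hX i l h, zero_mul]
  add_mem' := by
    intro X Y hX hY i j hij
    simp [hX i j hij, hY i j hij]
  algebraMap_mem' := by
    intro c i j hij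
    simp [Matrix.algebraMap_matrix_apply, hij]

/-- The `r × r` tangent algebra, augmented over `k^r` by `diag c + ε X ↦ c`. -/
def tangent (k : Type u) [Field k] (r : ℕ) : AugAlg.{u, u} k r where
  carrier := tangentSubalgebra k r
  unit :=
    { toFun := fun c => ⟨Matrix.diagonal fun i => TrivSqZeroExt.inl (c i), by
        intro i j hij; simp [Matrix.diagonal_apply_ne _ hij]⟩
      map_one' := by
        apply Subtype.ext; ext i j <;> by_cases h : i = j <;> simp [h]
      map_mul' := by
        intro c d; apply Subtype.ext
        simp [Matrix.diagonal_mul_diagonal]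
      map_zero' := by
        apply Subtype.ext; simp
      map_add' := by
        intro c d; apply Subtype.ext
        simp [Matrix.diagonal_add]
      commutes' := by
        intro c; apply Subtype.ext
        rfl }
  aug :=
    { toFun := fun X i => TrivSqZeroExt.fst (X.1 i i)
      map_one' := by funext i; simp
      map_mul' := by
        intro X Y; funext i
        simp only [MulMemClass.coe_mul, Matrix.mul_apply, TrivSqZeroExt.fst_sum,
          TrivSqZeroExt.fst_mul, Pi.mul_apply]
        refine Finset.sum_eq_single i (fun l _ hl => ?_) (by simp)
        rw [X.2 i l (Ne.symm hl), zero_mul]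
      map_zero' := by funext i; simp
      map_add' := by intro X Y; funext i; simp
      commutes' := by
        intro c; funext i
        simp [Matrix.algebraMap_matrix_apply, TrivSqZeroExt.algebraMap_eq_inl] }
  aug_unit c := by funext i; simp

/-- `H` as a right `k^r`-module, by multiplication on the right. -/
instance rightModule (H : AugAlg.{u, w} k r) : Module (Fin r → k) H.carrier where
  smul c h := h * H.unit c
  one_smul h := by change h * H.unit 1 = h; simp
  mul_smul c d h := by
    change h * H.unit (c * d) = h * H.unit d * H.unit c
    rw [mul_comm, map_mul, mul_assoc]
  smul_zero c := zero_mul _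
  smul_add c x y := add_mul _ _ _
  add_smul c d h := by
    change h * H.unit (c + d) = h * H.unit c + h * H.unit d
    rw [map_add, mul_add]
  zero_smul h := by change h * H.unit 0 = 0; simp

theorem right_smul_def (H : AugAlg.{u, w} k r) (c : Fin r → k) (h : H.carrier) :
    c • h = h * H.unit c := rfl

instance (H : AugAlg.{u, w} k r) : SMulCommClass (Fin r → k) H.carrier H.carrier where
  smul_comm c x h := by simp [right_smul_def, mul_assoc]

instance (H : AugAlg.{u, w} k r) : SMulCommClass (Fin r → k) k H.carrier where
  smul_comm c x h := by simp [right_smul_def]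

end AugAlg

open AugAlg

section Families

variable {k : Type u} [Field k] {r : ℕ}

/-- `H ⊗ M` over `k^r`, where `M = ⊕ M i` and `H` is a right `k^r`-module. It is a left
`H`-module. -/
abbrev Induced (H : AugAlg.{u, w} k r) (M : Fin r → Type v)
    [∀ i, AddCommGroup (M i)] [∀ i, Module k (M i)] : Type (max v w) :=
  H.carrier ⊗[Fin r → k] (∀ i, M i)

/-- The endomorphism algebra of the left `H`-module `H ⊗ M`, with endomorphisms acting on the
right; hence the opposite of the algebra of functions under composition. -/
abbrev EndInduced (H : AugAlg.{u, w} k r) (M : Fin r → Type v)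
    [∀ i, AddCommGroup (M i)] [∀ i, Module k (M i)] : Type (max v w) :=
  (Module.End H.carrier (Induced H M))ᵐᵒᵖ

variable (M : Fin r → Type v) [∀ i, AddCommGroup (M i)] [∀ i, Module k (M i)]

namespace AugAlg

/-- A morphism of augmented algebras is linear over `k^r`, acting on the right. -/
def Hom.toRight {H : AugAlg.{u, w} k r} {S : AugAlg.{u, w'} k r} (ψ : Hom H S) :
    H.carrier →ₗ[Fin r → k] S.carrier where
  toFun := ψ.toAlgHom
  map_add' := map_add _
  map_smul' c x := by simp [right_smul_def, ψ.map_unit]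

/-- The map `ψ ⊗ id : H ⊗ M → S ⊗ M`. -/
noncomputable def Hom.tensor {H : AugAlg.{u, w} k r} {S : AugAlg.{u, w'} k r} (ψ : Hom H S) :
    Induced H M →ₗ[Fin r → k] Induced S M :=
  LinearMap.rTensor _ ψ.toRight

theorem Hom.tensor_tmul {H : AugAlg.{u, w} k r} {S : AugAlg.{u, w'} k r} (ψ : Hom H S)
    (x : H.carrier) (m : ∀ i, M i) :
    ψ.tensor M (x ⊗ₜ m) = ψ.toAlgHom x ⊗ₜ[Fin r → k] m := rfl

theorem Hom.tensor_smul {H : AugAlg.{u, w} k r} {S : AugAlg.{u, w'} k r} (ψ : Hom H S)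
    (x : H.carrier) (z : Induced H M) :
    ψ.tensor M (x • z) = ψ.toAlgHom x • ψ.tensor M z := by
  induction z using TensorProduct.induction_on with
  | zero => simp
  | tmul y m => simp [TensorProduct.smul_tmul', Hom.tensor_tmul]
  | add y z hy hz => simp only [smul_add, map_add, hy, hz]

theorem unit_smul_tmul (S : AugAlg.{u, w'} k r) (c : Fin r → k) (m : ∀ i, M i) :
    S.unit c • ((1 : S.carrier) ⊗ₜ[Fin r → k] m) = (1 : S.carrier) ⊗ₜ[Fin r → k] (c • m) := by
  rw [← TensorProduct.smul_tmul, TensorProduct.smul_tmul', right_smul_def]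
  simp

/-- Extension of scalars of an endomorphism along `ψ`: the `S`-linear endomorphism of
`S ⊗ M` with `s ⊗ m ↦ s • (ψ ⊗ id) (f (1 ⊗ m))`. It is `id ⊗ f` under
`S ⊗ M = S ⊗_H (H ⊗ M)`. -/
noncomputable def extendFun {H : AugAlg.{u, w} k r} {S : AugAlg.{u, w'} k r} (ψ : Hom H S)
    (f : Module.End H.carrier (Induced H M)) : Module.End S.carrier (Induced S M) where
  toFun := TensorProduct.liftAddHom
    { toFun := fun s =>
        { toFun := fun m => s • ψ.tensor M (f ((1 : H.carrier) ⊗ₜ m))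
          map_zero' := by simp
          map_add' := by intro m m'; simp [TensorProduct.tmul_add] }
      map_zero' := by ext m; simp
      map_add' := by intro s t; ext m; simp [add_smul] }
    (by
      intro c s m
      change (c • s) • ψ.tensor M (f ((1 : H.carrier) ⊗ₜ m))
        = s • ψ.tensor M (f ((1 : H.carrier) ⊗ₜ (c • m)))
      rw [← unit_smul_tmul, map_smul, Hom.tensor_smul, ψ.map_unit, right_smul_def, mul_smul])
  map_add' := map_add _
  map_smul' s z := by
    induction z using TensorProduct.induction_on with
    | zero => simp
    | tmul y m => simp [TensorProduct.smul_tmul', mul_smul]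
    | add y z hy hz => simp only [smul_add, map_add, hy, hz]

theorem extendFun_tmul {H : AugAlg.{u, w} k r} {S : AugAlg.{u, w'} k r} (ψ : Hom H S)
    (f : Module.End H.carrier (Induced H M)) (s : S.carrier) (m : ∀ i, M i) :
    extendFun M ψ f (s ⊗ₜ m) = s • ψ.tensor M (f ((1 : H.carrier) ⊗ₜ m)) := rfl

theorem extendFun_tensor {H : AugAlg.{u, w} k r} {S : AugAlg.{u, w'} k r} (ψ : Hom H S)
    (f : Module.End H.carrier (Induced H M)) (z : Induced H M) :
    extendFun M ψ f (ψ.tensor M z) = ψ.tensor M (f z) := by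
  induction z using TensorProduct.induction_on with
  | zero => simp
  | tmul y m =>
    rw [Hom.tensor_tmul, extendFun_tmul, ← Hom.tensor_smul, ← map_smul,
      TensorProduct.smul_tmul', smul_eq_mul, mul_one]
  | add y z hy hz => simp only [map_add, hy, hz]

/-- The algebra homomorphism `End_H (H ⊗ M) → End_S (S ⊗ M)` induced by a morphism `ψ`. -/
noncomputable def extend {H : AugAlg.{u, w} k r} {S : AugAlg.{u, w'} k r} (ψ : Hom H S) :
    EndInduced H M →ₐ[k] EndInduced S M :=
  AlgHom.op
    { toFun := extendFun M ψ
      map_one' := by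
        refine LinearMap.ext fun z => ?_
        induction z using TensorProduct.induction_on with
        | zero => simp
        | tmul y m => simp [extendFun_tmul, Hom.tensor_tmul, TensorProduct.smul_tmul']
        | add y z hy hz => simp only [map_add, hy, hz]
      map_mul' := by
        intro f g
        refine LinearMap.ext fun z => ?_
        induction z using TensorProduct.induction_on with
        | zero => simp
        | tmul y m =>
          simp only [Module.End.mul_apply, extendFun_tmul, map_smul, extendFun_tensor]
        | add y z hy hz => simp only [map_add, hy, hz]
      map_zero' := by
        refine LinearMap.ext fun z => ?_
        induction z using TensorProduct.induction_on with
        | zero => simp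
        | tmul y m => simp [extendFun_tmul]
        | add y z hy hz => simp only [map_add, hy, hz]
      map_add' := by
        intro f g
        refine LinearMap.ext fun z => ?_
        induction z using TensorProduct.induction_on with
        | zero => simp
        | tmul y m => simp [extendFun_tmul]
        | add y z hy hz => simp only [map_add, hy, hz]
      commutes' := by
        intro c
        refine LinearMap.ext fun z => ?_
        induction z using TensorProduct.induction_on with
        | zero => simp
        | tmul y m =>
          simp [extendFun_tmul, Module.algebraMap_end_apply, TensorProduct.smul_tmul',
            Hom.tensor_tmul]
        | add y z hy hz => simp only [map_add, hy, hz] }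

/-- A `k^r`-linear endomorphism `f` of `M` acts on `H ⊗ M` by `id ⊗ f`. -/
noncomputable def idTensor (H : AugAlg.{u, w} k r)
    (f : (∀ i, M i) →ₗ[Fin r → k] (∀ i, M i)) : Module.End H.carrier (Induced H M) where
  toFun := LinearMap.lTensor H.carrier f
  map_add' := map_add _
  map_smul' x z := by
    induction z using TensorProduct.induction_on with
    | zero => simp
    | tmul y m => simp [TensorProduct.smul_tmul']
    | add y z hy hz => simp only [smul_add, map_add, hy, hz]

/-- The structure map `k^r → End_H (H ⊗ M)`, where `c` acts by `id ⊗ c`. -/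
noncomputable def scalarMap (H : AugAlg.{u, w} k r) (c : Fin r → k) : EndInduced H M :=
  MulOpposite.op (idTensor M H (LinearMap.lsmul (Fin r → k) (∀ i, M i) c))

end AugAlg

variable {A : Type v} [Ring A] [Algebra k A]
  [∀ i, Module Aᵐᵒᵖ (M i)] [∀ i, IsScalarTower k Aᵐᵒᵖ (M i)]

/-- Right multiplication by `a` on `M = ⊕ M i`. -/
def rightMul (a : A) : (∀ i, M i) →ₗ[Fin r → k] (∀ i, M i) where
  toFun m i := MulOpposite.op a • m i
  map_add' m m' := by funext i; simp
  map_smul' c m := by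
    funext i
    simp only [Pi.smul_apply', RingHom.id_apply]
    exact smul_comm _ _ _

/-- The homomorphism `⊕ η_{M i}` from `A` to `⊕ End_k (M i)`, the latter being realised as
the algebra of endomorphisms of `k^r ⊗ M = M` over `k^r`. -/
noncomputable def structureFamily : A →ₐ[k] EndInduced (AugAlg.base k r) M where
  toFun a := MulOpposite.op (idTensor M (AugAlg.base k r) (rightMul M a))
  map_one' := by
    apply MulOpposite.unop_injective
    refine LinearMap.ext fun z => ?_
    induction z using TensorProduct.induction_on with
    | zero => simp
    | tmul y m => simp [idTensor, rightMul]
    | add y z hy hz => simp only [map_add, hy, hz]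
  map_mul' a b := by
    apply MulOpposite.unop_injective
    refine LinearMap.ext fun z => ?_
    induction z using TensorProduct.induction_on with
    | zero => simp
    | tmul y m => simp [idTensor, rightMul, mul_smul]
    | add y z hy hz => simp only [map_add, hy, hz]
  map_zero' := by
    apply MulOpposite.unop_injective
    refine LinearMap.ext fun z => ?_
    induction z using TensorProduct.induction_on with
    | zero => simp
    | tmul y m =>
      have : rightMul (k := k) M (0 : A) m = 0 := by funext i; simp [rightMul]
      simp [idTensor, this]
    | add y z hy hz => simp only [map_add, hy, hz]
  map_add' a b := by
    apply MulOpposite.unop_injective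
    refine LinearMap.ext fun z => ?_
    induction z using TensorProduct.induction_on with
    | zero => simp
    | tmul y m =>
      have : rightMul (k := k) M (a + b) m = rightMul (k := k) M a m + rightMul (k := k) M b m := by
        funext i; simp [rightMul, add_smul]
      simp [idTensor, this, TensorProduct.tmul_add]
    | add y z hy hz => simp only [map_add, hy, hz]
  commutes' c := by
    apply MulOpposite.unop_injective
    refine LinearMap.ext fun z => ?_
    induction z using TensorProduct.induction_on with
    | zero => simp
    | tmul y m =>
      have h : rightMul (k := k) M (algebraMap k A c) m = (fun _ : Fin r => c) • m := by
        funext i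
        change MulOpposite.op (algebraMap k A c) • m i = c • m i
        rw [← algebraMap_smul Aᵐᵒᵖ c (m i)]
        rfl
      have h2 : (fun _ : Fin r => c) • y = c • y := by
        rw [right_smul_def, Algebra.smul_def, Algebra.commutes]
        rfl
      change y ⊗ₜ[Fin r → k] (rightMul (k := k) M (algebraMap k A c) m) = c • (y ⊗ₜ[Fin r → k] m)
      rw [h, ← TensorProduct.smul_tmul, h2, TensorProduct.smul_tmul']
    | add y z hy hz => simp only [map_add, hy, hz]

variable {M}

/-- A homomorphism `A → End_H (H ⊗ M)` that reduces to `⊕ η_{M i}` along the augmentation. -/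
def IsFamily (H : AugAlg.{u, w} k r) (ρ : A →ₐ[k] EndInduced H M) : Prop :=
  (AugAlg.extend M H.augHom).comp ρ = structureFamily M

/-- Two homomorphisms `A → End_S (S ⊗ M)` define isomorphic families: they are conjugate by
an automorphism of `S ⊗ M` that reduces to the identity of `M` along the augmentation. -/
def FamilyEquiv (S : AugAlg.{u, w} k r) (φ φ' : A →ₐ[k] EndInduced S M) : Prop :=
  ∃ g : (EndInduced S M)ˣ, AugAlg.extend M S.augHom (g : EndInduced S M) = 1 ∧
    ∀ a, φ' a * (g : EndInduced S M) = (g : EndInduced S M) * φ a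

/-- `(H, ρ)` is a pre-completion of `A` in `M` (a versal family for `M`): `H` is complete, `ρ`
lifts `⊕ η_{M i}`, each family `φ` over a complete augmented algebra `S` is obtained, up to
isomorphism of families, from `ρ` along some morphism `ψ : H → S`, and `ψ` is unique if `S`
is isomorphic to the tangent algebra. -/
structure IsPreCompletion (H : AugAlg.{u, max u v} k r) (ρ : A →ₐ[k] EndInduced H M) : Prop where
  complete : H.IsComplete
  isFamily : IsFamily H ρ
  versal : ∀ (S : AugAlg.{u, max u v} k r), S.IsComplete →
    ∀ φ : A →ₐ[k] EndInduced S M, IsFamily S φ →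
      ∃ ψ : Hom H S, FamilyEquiv S ((AugAlg.extend M ψ).comp ρ) φ
  unique : ∀ (S : AugAlg.{u, max u v} k r), S.IsIso (tangent k r) →
    ∀ φ : A →ₐ[k] EndInduced S M, IsFamily S φ → ∀ ψ ψ' : Hom H S,
      FamilyEquiv S ((AugAlg.extend M ψ).comp ρ) φ →
      FamilyEquiv S ((AugAlg.extend M ψ').comp ρ) φ → ψ = ψ'

/-- The ring of functions locally defined at `M`: the subalgebra of the completion
`End_H (H ⊗ M)` generated over `k^r` by the image of `A` and by the inverses of those
`ρ a` which are units. -/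
noncomputable def localFunctions {H : AugAlg.{u, w} k r} (ρ : A →ₐ[k] EndInduced H M) :
    Subalgebra k (EndInduced H M) :=
  Algebra.adjoin k (Set.range (AugAlg.scalarMap M H) ∪ Set.range ρ ∪
    {x | ∃ a, x * ρ a = 1 ∧ ρ a * x = 1})

/-- The natural homomorphism from `A` to the ring of local functions at `M`. -/
noncomputable def eta {H : AugAlg.{u, w} k r} (ρ : A →ₐ[k] EndInduced H M) :
    A →ₐ[k] localFunctions ρ :=
  ρ.codRestrict (localFunctions ρ) fun a =>
    Algebra.subset_adjoin (Or.inl (Or.inr ⟨a, rfl⟩))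

end Families

/-- `M 0, …, M (r - 1)` is the set of all simple right `A`-modules: each simple right module is
isomorphic to exactly one of them. Simple modules are quotients of `A`, so it suffices to
consider modules in the universe of `A`. -/
structure IsSimpleSystem (A : Type v) [Ring A] {r : ℕ} (M : Fin r → Type v)
    [∀ i, AddCommGroup (M i)] [∀ i, Module Aᵐᵒᵖ (M i)] : Prop where
  simple : ∀ i, IsSimpleModule Aᵐᵒᵖ (M i)
  distinct : ∀ i j, Nonempty (M i ≃ₗ[Aᵐᵒᵖ] M j) → i = j
  exhaustive : ∀ (N : Type v) [AddCommGroup N] [Module Aᵐᵒᵖ N] [IsSimpleModule Aᵐᵒᵖ N],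
    ∃ i, Nonempty (N ≃ₗ[Aᵐᵒᵖ] M i)

end LocalFunctions

/-! The algebra `A` turns out to be its own completion. Fix bases of the `M i`, with union `ι`, and
one base vector in each block. The matrix units of `⊕ End_k (M i)` that start or end at a base
vector then live in `End_S (S ⊗ M)` for every augmented `S`, and `S` is recovered as the corner cut
out by the base idempotents. A `Frame` records this Morita-type situation: an algebra with such
matrix units and a corner identified with `S` is determined by `S`.

Existence. Over an algebraically closed field, Schur's lemma and the density theorem make `A → ⊕
End_k (M i)` surjective. Its kernel lies in the Jacobson radical, hence is nil, so the matrix units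
lift to `A` (`MatrixUnits.exists_lift`). Let `H` be the corner of `A` at the lifted base
idempotents, the basic algebra of `A`. Then `A` has a frame over `H`, which gives a bijective family
`A → End_H (H ⊗ M)`, and the augmentation ideal of `H` is nilpotent.

This family is versal. Over a complete `S`, a family `φ` is conjugated by `∑ φ(p α) q α`, which
reduces to `1` and so is a unit, into one that preserves matrix units; its restriction to the corner
is the required morphism `H → S`. Over the tangent algebra the corner of a conjugating unit is
central, so the morphism is unique.

An arbitrary pre-completion `(H, ρ)` is compared with this one, `(H₀, ρ₀)`, by morphisms `ψ₀ : H₀ →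
H` and `ψ : H → H₀` (`IsPreCompletion.bijective`). Bijectivity of `ρ₀` makes `ψ₀` injective.
Uniqueness over the tangent algebra makes `ψ₀ ∘ ψ` the identity modulo the square of the
augmentation ideal, and nilpotency then makes `ψ₀` surjective. Hence `ρ` is bijective, and the
subalgebra of local functions is the whole endomorphism algebra. -/

namespace LocalFunctions
open AugAlg

/-! ### Functoriality of `End_S (S ⊗ M)` and equivalence of families -/

section Functoriality

universe w₁ w₂ w₃

variable {k : Type u} [Field k] {r : ℕ}

namespace AugAlg

/-- Composition of morphisms of augmented algebras. -/
def Hom.comp {H : AugAlg.{u, w₁} k r} {S : AugAlg.{u, w₂} k r} {T : AugAlg.{u, w₃} k r}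
    (ψ : Hom S T) (χ : Hom H S) : Hom H T where
  toAlgHom := ψ.toAlgHom.comp χ.toAlgHom
  map_unit c := by simp [χ.map_unit, ψ.map_unit]
  map_aug x := by simp [χ.map_aug, ψ.map_aug]

/-- The identity morphism. -/
def Hom.id (H : AugAlg.{u, w} k r) : Hom H H where
  toAlgHom := AlgHom.id k _
  map_unit _ := rfl
  map_aug _ := rfl

/-- The inverse of a bijective morphism. -/
noncomputable def Hom.inverse {H : AugAlg.{u, w₁} k r} {S : AugAlg.{u, w₂} k r} (ψ : Hom H S)
    (h : Function.Bijective ψ.toAlgHom) : Hom S H where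
  toAlgHom := (AlgEquiv.ofBijective ψ.toAlgHom h).symm
  map_unit c := by
    change (AlgEquiv.ofBijective ψ.toAlgHom h).symm _ = _
    rw [AlgEquiv.symm_apply_eq]
    exact (ψ.map_unit c).symm
  map_aug x := by
    rw [← ψ.map_aug]
    exact congrArg S.aug ((AlgEquiv.ofBijective ψ.toAlgHom h).apply_symm_apply x)

theorem Hom.comp_inverse {H : AugAlg.{u, w₁} k r} {S : AugAlg.{u, w₂} k r} (ψ : Hom H S)
    (h : Function.Bijective ψ.toAlgHom) : ψ.comp (ψ.inverse h) = Hom.id S :=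
  Hom.ext <| AlgHom.ext fun x => (AlgEquiv.ofBijective ψ.toAlgHom h).apply_symm_apply x

theorem Hom.inverse_comp {H : AugAlg.{u, w₁} k r} {S : AugAlg.{u, w₂} k r} (ψ : Hom H S)
    (h : Function.Bijective ψ.toAlgHom) : (ψ.inverse h).comp ψ = Hom.id H :=
  Hom.ext <| AlgHom.ext fun x => (AlgEquiv.ofBijective ψ.toAlgHom h).symm_apply_apply x

theorem augHom_comp {H : AugAlg.{u, w₁} k r} {S : AugAlg.{u, w₂} k r} (ψ : Hom H S) :
    S.augHom.comp ψ = H.augHom :=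
  Hom.ext <| AlgHom.ext ψ.map_aug

theorem induced_hom_ext {M : Fin r → Type v} [∀ i, AddCommGroup (M i)] [∀ i, Module k (M i)]
    {S : AugAlg.{u, w} k r} {f g : Module.End S.carrier (Induced S M)}
    (h : ∀ m, f ((1 : S.carrier) ⊗ₜ m) = g ((1 : S.carrier) ⊗ₜ m)) : f = g := by
  refine LinearMap.ext fun z => ?_
  induction z using TensorProduct.induction_on with
  | zero => simp
  | tmul y m =>
    have : y ⊗ₜ[Fin r → k] m = y • ((1 : S.carrier) ⊗ₜ m) := by
      rw [TensorProduct.smul_tmul', smul_eq_mul, mul_one]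
    rw [this, map_smul, map_smul, h]
  | add y z hy hz => simp only [map_add, hy, hz]

variable (M : Fin r → Type v) [∀ i, AddCommGroup (M i)] [∀ i, Module k (M i)]

theorem unop_extend_one_tmul {H : AugAlg.{u, w₁} k r} {S : AugAlg.{u, w₂} k r} (ψ : Hom H S)
    (f : EndInduced H M) (m : ∀ i, M i) :
    (extend M ψ f).unop ((1 : S.carrier) ⊗ₜ m) = ψ.tensor M (f.unop ((1 : H.carrier) ⊗ₜ m)) := by
  change extendFun M ψ f.unop _ = _
  rw [extendFun_tmul, one_smul]

theorem Hom.tensor_comp {H : AugAlg.{u, w₁} k r} {S : AugAlg.{u, w₂} k r}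
    {T : AugAlg.{u, w₃} k r} (ψ : Hom S T) (χ : Hom H S) (z : Induced H M) :
    (ψ.comp χ).tensor M z = ψ.tensor M (χ.tensor M z) := by
  induction z using TensorProduct.induction_on with
  | zero => simp
  | tmul y m => rfl
  | add y z hy hz => simp only [map_add, hy, hz]

theorem extend_comp {H : AugAlg.{u, w₁} k r} {S : AugAlg.{u, w₂} k r}
    {T : AugAlg.{u, w₃} k r} (ψ : Hom S T) (χ : Hom H S) :
    extend M (ψ.comp χ) = (extend M ψ).comp (extend M χ) := by
  refine AlgHom.ext fun f => MulOpposite.unop_injective (induced_hom_ext fun m => ?_)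
  rw [AlgHom.comp_apply, unop_extend_one_tmul, unop_extend_one_tmul, unop_extend_one_tmul,
    Hom.tensor_comp]

theorem extend_id (H : AugAlg.{u, w} k r) : extend M (Hom.id H) = AlgHom.id k _ := by
  refine AlgHom.ext fun f => MulOpposite.unop_injective (induced_hom_ext fun m => ?_)
  rw [unop_extend_one_tmul]
  change _ = f.unop _
  generalize f.unop ((1 : H.carrier) ⊗ₜ m) = z
  induction z using TensorProduct.induction_on with
  | zero => simp
  | tmul y m => rfl
  | add y z hy hz => simp only [map_add, hy, hz]

theorem extend_bijective {H : AugAlg.{u, w₁} k r} {S : AugAlg.{u, w₂} k r} (ψ : Hom H S)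
    (h : Function.Bijective ψ.toAlgHom) : Function.Bijective (extend M ψ) := by
  refine Function.bijective_iff_has_inverse.mpr ⟨extend M (ψ.inverse h), fun x => ?_, fun x => ?_⟩
  · rw [← AlgHom.comp_apply, ← extend_comp, ψ.inverse_comp h, extend_id, AlgHom.id_apply]
  · rw [← AlgHom.comp_apply, ← extend_comp, ψ.comp_inverse h, extend_id, AlgHom.id_apply]

theorem extend_idTensor {H : AugAlg.{u, w₁} k r} {S : AugAlg.{u, w₂} k r} (ψ : Hom H S)
    (f : (∀ i, M i) →ₗ[Fin r → k] (∀ i, M i)) :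
    extend M ψ (MulOpposite.op (idTensor M H f)) = MulOpposite.op (idTensor M S f) := by
  refine MulOpposite.unop_injective (induced_hom_ext fun m => ?_)
  rw [unop_extend_one_tmul]
  change ψ.tensor M ((1 : H.carrier) ⊗ₜ f m) = (1 : S.carrier) ⊗ₜ f m
  rw [Hom.tensor_tmul, map_one]

end AugAlg

variable {M : Fin r → Type v} [∀ i, AddCommGroup (M i)] [∀ i, Module k (M i)]
variable {A : Type v} [Ring A] [Algebra k A]

theorem IsFamily.extend [∀ i, Module Aᵐᵒᵖ (M i)] [∀ i, IsScalarTower k Aᵐᵒᵖ (M i)]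
    {H : AugAlg.{u, w₁} k r} {S : AugAlg.{u, w₂} k r} {ρ : A →ₐ[k] EndInduced H M}
    (h : IsFamily H ρ) (ψ : Hom H S) : IsFamily S ((AugAlg.extend M ψ).comp ρ) := by
  rw [IsFamily, ← AlgHom.comp_assoc, ← extend_comp, augHom_comp]
  exact h

theorem FamilyEquiv.refl {S : AugAlg.{u, w} k r} (φ : A →ₐ[k] EndInduced S M) :
    FamilyEquiv S φ φ :=
  ⟨1, by simp, by simp⟩

theorem FamilyEquiv.symm {S : AugAlg.{u, w} k r} {φ φ' : A →ₐ[k] EndInduced S M}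
    (h : FamilyEquiv S φ φ') : FamilyEquiv S φ' φ := by
  obtain ⟨g, hg, h⟩ := h
  refine ⟨g⁻¹, ?_, fun a => ?_⟩
  · have := congrArg (AugAlg.extend M S.augHom) g.mul_inv
    rwa [map_mul, hg, one_mul, map_one] at this
  · rw [Units.mul_inv_eq_iff_eq_mul, mul_assoc, Units.eq_inv_mul_iff_mul_eq]
    exact (h a).symm

theorem FamilyEquiv.trans {S : AugAlg.{u, w} k r} {φ φ' φ'' : A →ₐ[k] EndInduced S M}
    (h : FamilyEquiv S φ φ') (h' : FamilyEquiv S φ' φ'') : FamilyEquiv S φ φ'' := by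
  obtain ⟨g, hg, h⟩ := h
  obtain ⟨g', hg', h'⟩ := h'
  refine ⟨g' * g, by simp [hg, hg'], fun a => ?_⟩
  rw [Units.val_mul, ← mul_assoc, h', mul_assoc, h, mul_assoc]

theorem FamilyEquiv.extend {H : AugAlg.{u, w₁} k r} {S : AugAlg.{u, w₂} k r}
    {φ φ' : A →ₐ[k] EndInduced H M} (h : FamilyEquiv H φ φ') (ψ : Hom H S) :
    FamilyEquiv S ((AugAlg.extend M ψ).comp φ) ((AugAlg.extend M ψ).comp φ') := by
  obtain ⟨g, hg, h⟩ := h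
  refine ⟨Units.map (AugAlg.extend M ψ : EndInduced H M →* EndInduced S M) g, ?_, fun a => ?_⟩
  · change AugAlg.extend M S.augHom (AugAlg.extend M ψ g) = 1
    rw [← AlgHom.comp_apply, ← extend_comp, augHom_comp, hg]
  · change AugAlg.extend M ψ (φ' a) * AugAlg.extend M ψ g =
      AugAlg.extend M ψ g * AugAlg.extend M ψ (φ a)
    rw [← map_mul, h, map_mul]

theorem FamilyEquiv.bijective_iff {S : AugAlg.{u, w} k r} {φ φ' : A →ₐ[k] EndInduced S M}
    (h : FamilyEquiv S φ φ') (hφ : Function.Bijective φ) : Function.Bijective φ' := by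
  obtain ⟨g, -, h⟩ := h
  have h' : ∀ a, φ' a = g * φ a * ↑g⁻¹ := fun a => by
    rw [Units.eq_mul_inv_iff_mul_eq, h]
  refine ⟨fun a b hab => hφ.1 ?_, fun y => ?_⟩
  · rw [h', h'] at hab
    simpa using hab
  · obtain ⟨a, ha⟩ := hφ.2 (↑g⁻¹ * y * g)
    exact ⟨a, by rw [h', ha]; simp [mul_assoc]⟩

end Functoriality

/-! ### Matrix units: conjugacy and lifting -/

section MatrixUnits

variable {r : ℕ} {ι : Type*} [Fintype ι] [DecidableEq ι]

/-- Elements `p α`, `q α` of a ring such that the products `p α * q β`, for `t α = t β`, form a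
complete system of matrix units; `t α` is the number of the block of `α`, and `b i` is a base
point of the block `i`. -/
structure MatrixUnits (t : ι → Fin r) (b : Fin r → ι) (B : Type*) [Ring B] where
  p : ι → B
  q : ι → B
  base : ∀ i, p (b i) = q (b i)
  q_mul_p : ∀ α β, q α * p β = if α = β then p (b (t α)) else 0
  sum_p_mul_q : ∑ α, p α * q α = 1

namespace MatrixUnits

variable {t : ι → Fin r} {b : Fin r → ι} {B : Type*} [Ring B] (X : MatrixUnits t b B)

theorem q_mul_p_self (α : ι) : X.q α * X.p α = X.p (b (t α)) := by
  rw [X.q_mul_p, if_pos rfl]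

theorem q_mul_p_ne {α β : ι} (h : α ≠ β) : X.q α * X.p β = 0 := by
  rw [X.q_mul_p, if_neg h]

/-- Insert `∑ p β * q β = 1`: orthogonality leaves only the term `β = α`. The same device gives the
dual statement and the two formulas for `intertwiner`. -/
theorem p_mul_base (α : ι) : X.p α * X.p (b (t α)) = X.p α := by
  conv_rhs => rw [← one_mul (X.p α), ← X.sum_p_mul_q, Finset.sum_mul]
  rw [Finset.sum_eq_single α]
  · rw [mul_assoc, q_mul_p_self]
  · intro β _ h
    rw [mul_assoc, X.q_mul_p_ne h, mul_zero]
  · simp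

theorem base_mul_q (α : ι) : X.p (b (t α)) * X.q α = X.q α := by
  conv_rhs => rw [← mul_one (X.q α), ← X.sum_p_mul_q, Finset.mul_sum]
  rw [Finset.sum_eq_single α]
  · rw [← mul_assoc, q_mul_p_self]
  · intro β _ h
    rw [← mul_assoc, X.q_mul_p_ne h.symm, zero_mul]
  · simp

theorem base_mul_base (htb : ∀ i, t (b i) = i) (i j : Fin r) :
    X.p (b i) * X.p (b j) = if i = j then X.p (b i) else 0 := by
  conv_lhs => rw [X.base i]
  by_cases h : i = j
  · subst h
    rw [X.q_mul_p_self, htb, if_pos rfl]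
  · rw [X.q_mul_p_ne, if_neg h]
    intro h'
    exact h (by rw [← htb i, h', htb])

/-- The image of a system of matrix units under a ring homomorphism. -/
@[simps]
def map {C : Type*} [Ring C] (f : B →+* C) : MatrixUnits t b C where
  p α := f (X.p α)
  q α := f (X.q α)
  base i := by rw [X.base]
  q_mul_p α β := by
    rw [← map_mul, X.q_mul_p]
    split_ifs <;> simp
  sum_p_mul_q := by
    simp_rw [← map_mul]
    rw [← map_sum, X.sum_p_mul_q, map_one]

/-- The canonical element that intertwines two systems of matrix units. -/
def intertwiner (Y : MatrixUnits t b B) : B := ∑ α, X.p α * Y.q α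

variable (Y : MatrixUnits t b B)

theorem intertwiner_mul_p (β : ι) :
    X.intertwiner Y * Y.p β = X.p β * Y.p (b (t β)) := by
  rw [intertwiner, Finset.sum_mul, Finset.sum_eq_single β]
  · rw [mul_assoc, Y.q_mul_p_self]
  · intro α _ h
    rw [mul_assoc, Y.q_mul_p_ne h, mul_zero]
  · simp

theorem q_mul_intertwiner (β : ι) :
    X.q β * X.intertwiner Y = X.p (b (t β)) * Y.q β := by
  rw [intertwiner, Finset.mul_sum, Finset.sum_eq_single β]
  · rw [← mul_assoc, X.q_mul_p_self]
  · intro α _ h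
    rw [← mul_assoc, X.q_mul_p_ne h.symm, zero_mul]
  · simp

theorem p_mul_intertwiner (htb : ∀ i, t (b i) = i) (β : ι) :
    X.p β * X.intertwiner Y = X.intertwiner Y * Y.p β := by
  rw [intertwiner_mul_p, ← X.p_mul_base β, mul_assoc, X.base, q_mul_intertwiner, htb,
    ← Y.base, ← X.base, ← mul_assoc]

theorem q_mul_intertwiner_comm (htb : ∀ i, t (b i) = i) (β : ι) :
    X.q β * X.intertwiner Y = X.intertwiner Y * Y.q β := by
  rw [q_mul_intertwiner, ← Y.base_mul_q β, ← mul_assoc (X.intertwiner Y), intertwiner_mul_p,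
    htb, mul_assoc, Y.base_mul_q]

/-- Two systems of matrix units are conjugate if their canonical intertwiner is a unit. -/
theorem conj_of_intertwiner (htb : ∀ i, t (b i) = i) (g : Bˣ) (hg : (g : B) = X.intertwiner Y)
    (β : ι) : ↑g⁻¹ * X.p β * g = Y.p β ∧ ↑g⁻¹ * X.q β * g = Y.q β := by
  constructor
  · rw [mul_assoc, Units.inv_mul_eq_iff_eq_mul, hg, p_mul_intertwiner X Y htb]
  · rw [mul_assoc, Units.inv_mul_eq_iff_eq_mul, hg, q_mul_intertwiner_comm X Y htb]

/-- Peirce decomposition; the inner factors `q α * x * p β` lie in the corner of the base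
idempotents and serve as matrix entries. -/
theorem eq_sum (x : B) : x = ∑ α, ∑ β, X.p α * (X.q α * x * X.p β) * X.q β := by
  calc x = (∑ α, X.p α * X.q α) * x * ∑ β, X.p β * X.q β := by
        rw [X.sum_p_mul_q, one_mul, mul_one]
    _ = _ := by
        simp_rw [Finset.sum_mul, Finset.mul_sum, mul_assoc]

theorem isUnit_of_map_eq_one {C : Type*} [Ring C] (f : B →+* C)
    (hf : ∀ x, f x = 0 → IsNilpotent x) {x : B} (hx : f x = 1) : IsUnit x := by
  have : IsNilpotent (x - 1) := hf _ (by simp [hx])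
  simpa using this.isUnit_add_one

/-- Systems of matrix units lift along a surjection with nil kernel. -/
theorem exists_lift {C : Type*} [Ring C] (f : C →+* B) (hf : Function.Surjective f)
    (hnil : ∀ x, f x = 0 → IsNilpotent x) (htb : ∀ i, t (b i) = i) :
    ∃ Z : MatrixUnits t b C, (∀ α, f (Z.p α) = X.p α) ∧ ∀ α, f (Z.q α) = X.q α := by
  -- The diagonal units are lifted first, by idempotent lifting along a nil kernel; the off-diagonal
  -- ones are then adjusted to them.
  have hX : CompleteOrthogonalIdempotents fun α => X.p α * X.q α := by
    refine ⟨⟨fun α => ?_, fun α β h => ?_⟩, X.sum_p_mul_q⟩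
    · change X.p α * X.q α * (X.p α * X.q α) = X.p α * X.q α
      rw [mul_assoc, ← mul_assoc (X.q α), X.q_mul_p_self, X.base_mul_q]
    · change X.p α * X.q α * (X.p β * X.q β) = 0
      rw [mul_assoc, ← mul_assoc (X.q α), X.q_mul_p_ne h, zero_mul, mul_zero]
  obtain ⟨e, he, hfe⟩ := hX.lift_of_isNilpotent_ker f (fun x hx => hnil x hx)
    (fun α => hf _)
  have hfe (α) : f (e α) = X.p α * X.q α := congrFun hfe α
  have hee (α) : e α * e α = e α := he.idem α
  -- the lifts of the elements `p` and `q`, not yet normalised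
  choose p₀ hp₀ using fun α => hf (X.p α)
  choose q₀ hq₀ using fun α => hf (X.q α)
  -- Arbitrary lifts are cut down to the correct Peirce components, which does not change their
  -- images.
  set p₁ : ι → C := fun α => e α * p₀ α * e (b (t α)) with hp₁
  set q₁ : ι → C := fun α => e (b (t α)) * q₀ α * e α with hq₁
  have hfb (i) : f (e (b i)) = X.p (b i) := by
    rw [hfe, ← X.base, X.base_mul_base htb, if_pos rfl]
  have hfp (α) : f (p₁ α) = X.p α := by
    rw [hp₁, map_mul, map_mul, hfb, hfe, hp₀, mul_assoc (X.p α), X.q_mul_p_self, X.p_mul_base,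
      X.p_mul_base]
  have hfq (α) : f (q₁ α) = X.q α := by
    rw [hq₁, map_mul, map_mul, hfb, hfe, hq₀, X.base_mul_q, ← mul_assoc, X.q_mul_p_self,
      X.base_mul_q]
  have hep (α) : e α * p₁ α = p₁ α := by rw [hp₁]; simp only [← mul_assoc, hee]
  have hpe (α) : p₁ α * e (b (t α)) = p₁ α := by rw [hp₁]; simp only [mul_assoc, hee]
  have heq (α) : e (b (t α)) * q₁ α = q₁ α := by rw [hq₁]; simp only [← mul_assoc, hee]
  have hqe (α) : q₁ α * e α = q₁ α := by rw [hq₁]; simp only [mul_assoc, hee]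
  -- `q₁ α * p₁ α` should be a unit of the corner at `e (b (t α))`; adding the complementary
  -- idempotent turns this into a statement about units of `C`.
  have hunit (α) : IsUnit (q₁ α * p₁ α + (1 - e (b (t α)))) := by
    refine isUnit_of_map_eq_one f hnil ?_
    rw [map_add, map_mul, hfp, hfq, map_sub, hfb, map_one, X.q_mul_p_self]
    abel
  choose s hs using hunit
  have hse (α) : (s α : C) * e (b (t α)) = q₁ α * p₁ α := by
    rw [hs, add_mul, mul_assoc, hpe, sub_mul, hee, one_mul, sub_self, add_zero]
  have hes (α) : e (b (t α)) * (s α : C) = q₁ α * p₁ α := by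
    rw [hs, mul_add, ← mul_assoc, heq, mul_sub, hee, mul_one, sub_self, add_zero]
  have hes' (α) : e (b (t α)) * ↑(s α)⁻¹ = ↑(s α)⁻¹ * e (b (t α)) := by
    rw [Units.mul_inv_eq_iff_eq_mul, mul_assoc, Units.eq_inv_mul_iff_mul_eq, hse, hes]
  have hfs (α) : f ↑(s α)⁻¹ = 1 := by
    have h1 : f (s α) = 1 := by
      rw [hs, map_add, map_mul, hfp, hfq, map_sub, hfb, map_one, X.q_mul_p_self]
      abel
    have := congrArg f (s α).inv_mul
    rwa [map_mul, h1, mul_one, map_one] at this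
  -- Rescaling by the inverse makes `q₂ α * p₁ α` exactly the base idempotent.
  set q₂ : ι → C := fun α => ↑(s α)⁻¹ * q₁ α with hq₂
  have hfq₂ (α) : f (q₂ α) = X.q α := by rw [hq₂, map_mul, hfs, one_mul, hfq]
  have hq₂e (α) : q₂ α * e α = q₂ α := by rw [hq₂]; simp only [mul_assoc, hqe]
  have heq₂ (α) : e (b (t α)) * q₂ α = q₂ α := by
    rw [hq₂, ← mul_assoc, hes', mul_assoc, heq]
  have hqp (α) : q₂ α * p₁ α = e (b (t α)) := by
    rw [hq₂, mul_assoc, ← hse, Units.inv_mul_cancel_left]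
  have hqp' {α β} (h : α ≠ β) : q₂ α * p₁ β = 0 := by
    rw [← hq₂e, ← hep, mul_assoc, ← mul_assoc (e α), he.ortho h, zero_mul, mul_zero]
  -- The defect `e α - p₁ α * q₂ α` is idempotent and lies in the nil kernel, so it vanishes.
  have hpq (α) : p₁ α * q₂ α = e α := by
    have h1 : (e α - p₁ α * q₂ α) * (e α - p₁ α * q₂ α) = e α - p₁ α * q₂ α := by
      rw [sub_mul, mul_sub, mul_sub, hee, ← mul_assoc (e α), hep, mul_assoc (p₁ α) (q₂ α) (e α),
        hq₂e, mul_assoc (p₁ α), ← mul_assoc (q₂ α), hqp, heq₂]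
      abel
    have h2 : IsNilpotent (e α - p₁ α * q₂ α) := hnil _ (by
      rw [map_sub, map_mul, hfp, hfq₂, hfe, sub_self])
    obtain ⟨n, hn⟩ := h2
    have h3 : IsIdempotentElem (e α - p₁ α * q₂ α) := h1
    have h4 : e α - p₁ α * q₂ α = 0 := by
      rw [← h3.pow_succ_eq n, pow_succ, hn, zero_mul]
    exact (sub_eq_zero.mp h4).symm
  -- So far `p₁ (b i)` and `q₂ (b i)` are only mutually inverse in their corner, whereas the field
  -- `base` requires equality. Multiplying each `p₁` on the right by the base `q₂`, and each `q₂` on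
  -- the left by the base `p₁`, turns both into `e (b i)`.
  have hbq (i) : q₂ (b i) * p₁ (b i) = e (b i) := by rw [hqp, htb]
  have heqb (i) : e (b i) * q₂ (b i) = q₂ (b i) := by simpa [htb] using heq₂ (b i)
  -- translate the base point
  refine ⟨{ p := fun α => p₁ α * q₂ (b (t α))
            q := fun α => p₁ (b (t α)) * q₂ α
            base := fun i => by simp only [htb]
            q_mul_p := fun α β => ?_
            sum_p_mul_q := ?_ }, fun α => ?_, fun α => ?_⟩
  · split_ifs with h
    · subst h
      rw [htb, mul_assoc, ← mul_assoc (q₂ α), hqp, heqb]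
    · rw [mul_assoc, ← mul_assoc (q₂ α), hqp' h, zero_mul, mul_zero]
  · rw [← he.complete]
    refine Finset.sum_congr rfl fun α _ => ?_
    rw [mul_assoc, ← mul_assoc (q₂ (b _)), hbq, heq₂, hpq]
  · rw [map_mul, hfp, hfq₂, ← X.base, X.p_mul_base]
  · rw [map_mul, hfp, hfq₂, X.base_mul_q]

end MatrixUnits

end MatrixUnits

/-! ### Frames: algebras as generalised matrix algebras over a corner -/

section Frames

variable {k : Type u} [Field k] {r : ℕ} {ι : Type*} [Fintype ι] [DecidableEq ι]

/-- A system of matrix units in an algebra `B` together with an identification of the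
augmented algebra `S` with the corner of `B` cut out by the base idempotents. -/
structure Frame (S : AugAlg.{u, w} k r) (t : ι → Fin r) (b : Fin r → ι) (B : Type*) [Ring B]
    [Algebra k B] extends MatrixUnits t b B where
  c : S.carrier →ₗ[k] B
  d : B →ₗ[k] S.carrier
  c_mul : ∀ x y, c (x * y) = c x * c y
  d_c : ∀ x, d (c x) = x
  c_d : ∀ y, c (d y) = c 1 * y * c 1
  c_unit : ∀ i, c (S.unit (Pi.single i 1)) = p (b i)

namespace Frame

universe w₁ w₂

variable {t : ι → Fin r} {b : Fin r → ι} {S : AugAlg.{u, w₁} k r} {S' : AugAlg.{u, w₂} k r}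
  {B B' : Type*} [Ring B] [Algebra k B] [Ring B'] [Algebra k B']
  (F : Frame S t b B) (G : Frame S' t b B')

theorem c_injective : Function.Injective F.c := fun x y h => by rw [← F.d_c x, h, F.d_c]

theorem c_one : F.c 1 = ∑ i, F.p (b i) := by
  have : (1 : S.carrier) = ∑ i, S.unit (Pi.single i 1) := by
    rw [← map_sum, Finset.univ_sum_single]
    exact (map_one S.unit).symm
  rw [this, map_sum]
  simp_rw [F.c_unit]

theorem c_one_mul (x) : F.c 1 * F.c x = F.c x := by rw [← F.c_mul, one_mul]

theorem c_mul_one (x) : F.c x * F.c 1 = F.c x := by rw [← F.c_mul, mul_one]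

theorem c_one_mul_q (α : ι) : F.c 1 * F.q α = F.q α := by
  rw [← F.base_mul_q, ← F.c_unit, ← mul_assoc, c_one_mul]

theorem p_mul_c_one (α : ι) : F.p α * F.c 1 = F.p α := by
  rw [← F.p_mul_base, ← F.c_unit, mul_assoc, c_mul_one]

/-- The matrix of an element of `B`. -/
def toMatrix : B →ₗ[k] Matrix ι ι S.carrier where
  toFun x := Matrix.of fun α β => F.d (F.q α * x * F.p β)
  map_add' x y := by ext; simp [mul_add, add_mul]
  map_smul' x y := by ext; simp

theorem toMatrix_apply (x : B) (α β : ι) : F.toMatrix x α β = F.d (F.q α * x * F.p β) := rfl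

/-- `d` inverts `c` only on the corner, and `q α * x * p β` lies there. -/
theorem c_toMatrix (x : B) (α β : ι) : F.c (F.toMatrix x α β) = F.q α * x * F.p β := by
  rw [toMatrix_apply, F.c_d, mul_assoc, mul_assoc _ (F.p β), p_mul_c_one, ← mul_assoc, ← mul_assoc,
    c_one_mul_q]

/-- The element of `B` with a given matrix. -/
def ofMatrix : Matrix ι ι S.carrier →ₗ[k] B where
  toFun Y := ∑ α, ∑ β, F.p α * F.c (Y α β) * F.q β
  map_add' x y := by simp [mul_add, add_mul, Finset.sum_add_distrib]
  map_smul' x y := by simp [Finset.smul_sum]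

theorem ofMatrix_apply (Y : Matrix ι ι S.carrier) :
    F.ofMatrix Y = ∑ α, ∑ β, F.p α * F.c (Y α β) * F.q β := rfl

theorem ofMatrix_toMatrix (x : B) : F.ofMatrix (F.toMatrix x) = x := by
  rw [ofMatrix_apply]
  simp_rw [c_toMatrix]
  exact (F.eq_sum x).symm

theorem toMatrix_injective : Function.Injective F.toMatrix :=
  Function.LeftInverse.injective F.ofMatrix_toMatrix

theorem toMatrix_mul (x y : B) : F.toMatrix (x * y) = F.toMatrix x * F.toMatrix y := by
  ext α β
  apply F.c_injective
  rw [c_toMatrix, Matrix.mul_apply, map_sum]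
  simp_rw [F.c_mul, c_toMatrix]
  calc _ = F.q α * x * (∑ γ, F.p γ * F.q γ) * y * F.p β := by
        rw [F.sum_p_mul_q, mul_one, ← mul_assoc]
    _ = _ := by simp_rw [Finset.mul_sum, Finset.sum_mul, mul_assoc]

/-- `toMatrix` is multiplicative but not unital: it identifies `B` with the corner of the full
matrix ring at this diagonal idempotent. -/
theorem toMatrix_one :
    F.toMatrix 1 = Matrix.diagonal fun α => S.unit (Pi.single (t α) 1) := by
  ext α β
  apply F.c_injective
  rw [c_toMatrix, mul_one, F.q_mul_p, Matrix.diagonal_apply]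
  split_ifs with h
  · rw [F.c_unit]
  · simp

theorem ofMatrix_one : F.ofMatrix 1 = 1 := by
  rw [ofMatrix_apply, ← F.sum_p_mul_q]
  refine Finset.sum_congr rfl fun α _ => ?_
  rw [Finset.sum_eq_single α]
  · rw [Matrix.one_apply_eq, p_mul_c_one]
  · intro β _ h
    rw [Matrix.one_apply_ne h.symm]
    simp
  · simp

/-- `ofMatrix` is not multiplicative on all matrices; linearity over `B` on both sides replaces
this. -/
theorem mul_ofMatrix (x : B) (Y : Matrix ι ι S.carrier) :
    x * F.ofMatrix Y = F.ofMatrix (F.toMatrix x * Y) := by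
  calc x * F.ofMatrix Y = (∑ α, F.p α * F.q α) * x * F.ofMatrix Y := by
        rw [F.sum_p_mul_q, one_mul]
    _ = _ := by
        simp_rw [ofMatrix_apply, Matrix.mul_apply, map_sum, F.c_mul, c_toMatrix, Finset.mul_sum,
          Finset.sum_mul, mul_assoc]
        rw [Finset.sum_comm_cycle]
        exact Finset.sum_congr rfl fun α _ => Finset.sum_comm

theorem ofMatrix_mul (x : B) (Y : Matrix ι ι S.carrier) :
    F.ofMatrix Y * x = F.ofMatrix (Y * F.toMatrix x) := by
  calc F.ofMatrix Y * x = F.ofMatrix Y * (x * ∑ α, F.p α * F.q α) := by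
        rw [F.sum_p_mul_q, mul_one]
    _ = _ := by
        simp_rw [ofMatrix_apply, Matrix.mul_apply, map_sum, F.c_mul, c_toMatrix, Finset.mul_sum,
          Finset.sum_mul, mul_assoc]
        exact Finset.sum_comm

/-- `ofMatrix` sees only the part of a matrix inside the corner; `toMatrix` returns that part. -/
theorem toMatrix_ofMatrix (Y : Matrix ι ι S.carrier) :
    F.toMatrix (F.ofMatrix Y) = F.toMatrix 1 * Y * F.toMatrix 1 := by
  have h : F.ofMatrix (F.toMatrix 1 * Y * F.toMatrix 1) = F.ofMatrix Y := by
    rw [← ofMatrix_mul, ← mul_ofMatrix, mul_one, one_mul]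
  ext α β
  apply F.c_injective
  rw [c_toMatrix, toMatrix_one, Matrix.mul_diagonal, Matrix.diagonal_mul, F.c_mul, F.c_mul,
    F.c_unit, F.c_unit, ofMatrix_apply]
  rw [Finset.mul_sum, Finset.sum_eq_single α, Finset.mul_sum, Finset.sum_mul,
    Finset.sum_eq_single β]
  · rw [mul_assoc, mul_assoc (F.p α * _), F.q_mul_p_self, mul_assoc, ← mul_assoc (F.q α),
      F.q_mul_p_self, mul_assoc]
  · intro γ _ h
    rw [mul_assoc, mul_assoc (F.p α * _), F.q_mul_p_ne h, mul_zero, mul_zero]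
  · simp
  · intro γ _ h
    simp_rw [Finset.mul_sum, ← mul_assoc, F.q_mul_p_ne h.symm, zero_mul, Finset.sum_const_zero]
  · simp

/-- The matrix of an element of `B`, transported along a morphism of augmented algebras. -/
theorem toMatrix_one_map (ψ : Hom S S') :
    (F.toMatrix 1).map ψ.toAlgHom = G.toMatrix 1 := by
  rw [toMatrix_one, toMatrix_one, Matrix.diagonal_map (map_zero _)]
  simp_rw [ψ.map_unit]

/-- A morphism of augmented algebras induces a homomorphism of algebras with frames. -/
def mapHom (ψ : Hom S S') : B →ₐ[k] B' :=
  AlgHom.ofLinearMap (G.ofMatrix ∘ₗ (ψ.toAlgHom.toLinearMap.mapMatrix) ∘ₗ F.toMatrix)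
    (by
      change G.ofMatrix ((F.toMatrix 1).map ψ.toAlgHom) = 1
      rw [toMatrix_one_map F G, ofMatrix_toMatrix])
    (by
      intro x y
      change G.ofMatrix ((F.toMatrix (x * y)).map ψ.toAlgHom) =
        G.ofMatrix ((F.toMatrix x).map ψ.toAlgHom) * G.ofMatrix ((F.toMatrix y).map ψ.toAlgHom)
      rw [mul_ofMatrix, toMatrix_ofMatrix, ← toMatrix_one_map F G ψ, ← Matrix.map_mul,
        ← Matrix.map_mul, ← Matrix.map_mul, ← toMatrix_mul, ← toMatrix_mul, ← toMatrix_mul,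
        one_mul, mul_one])

theorem mapHom_apply (ψ : Hom S S') (x : B) :
    F.mapHom G ψ x = G.ofMatrix ((F.toMatrix x).map ψ.toAlgHom) := rfl

theorem toMatrix_mapHom (ψ : Hom S S') (x : B) :
    G.toMatrix (F.mapHom G ψ x) = (F.toMatrix x).map ψ.toAlgHom := by
  rw [mapHom_apply, toMatrix_ofMatrix, ← toMatrix_one_map F G ψ, ← Matrix.map_mul,
    ← Matrix.map_mul, ← toMatrix_mul, ← toMatrix_mul, one_mul, mul_one]

/-- A homomorphism of algebras with frames that lies over a morphism of augmented algebras. -/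
structure IsOver (ψ : Hom S S') (f : B →ₐ[k] B') : Prop where
  map_p : ∀ α, f (F.p α) = G.p α
  map_q : ∀ α, f (F.q α) = G.q α
  map_c : ∀ x, f (F.c x) = G.c (ψ.toAlgHom x)

variable {F G}

/-- The elements `p`, `q` and the image of `c` generate `B`. Equalities between families are proved
through this uniqueness. -/
theorem IsOver.eq {ψ : Hom S S'} {f g : B →ₐ[k] B'} (hf : F.IsOver G ψ f) (hg : F.IsOver G ψ g) :
    f = g := by
  refine AlgHom.ext fun x => ?_
  rw [← F.ofMatrix_toMatrix x, ofMatrix_apply]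
  simp only [map_sum, map_mul, hf.map_p, hf.map_q, hf.map_c, hg.map_p, hg.map_q, hg.map_c]

theorem IsOver.toMatrix {ψ : Hom S S'} {f : B →ₐ[k] B'} (hf : F.IsOver G ψ f) (x : B) :
    G.toMatrix (f x) = (F.toMatrix x).map ψ.toAlgHom := by
  ext α β
  apply G.c_injective
  rw [c_toMatrix, Matrix.map_apply, ← hf.map_c, c_toMatrix, map_mul, map_mul, hf.map_p, hf.map_q]

variable (F G)

theorem d_p (i : Fin r) : F.d (F.p (b i)) = S.unit (Pi.single i 1) := by
  rw [← F.c_unit, F.d_c]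

theorem toMatrix_p (α : ι) : F.toMatrix (F.p α) = Matrix.of fun β γ =>
    if β = α ∧ b (t α) = γ then S.unit (Pi.single (t γ) 1) else 0 := by
  ext β γ
  rw [toMatrix_apply, Matrix.of_apply, F.q_mul_p]
  by_cases h : β = α
  · subst h
    rw [if_pos rfl, F.base, F.q_mul_p]
    by_cases h' : b (t β) = γ
    · rw [if_pos h', if_pos ⟨rfl, h'⟩, d_p, ← h']
    · rw [if_neg h', if_neg fun h => h' h.2, map_zero]
  · rw [if_neg h, if_neg fun h' => h h'.1, zero_mul, map_zero]

theorem toMatrix_q (α : ι) : F.toMatrix (F.q α) = Matrix.of fun β γ =>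
    if β = b (t α) ∧ α = γ then S.unit (Pi.single (t β) 1) else 0 := by
  ext β γ
  rw [toMatrix_apply, Matrix.of_apply, mul_assoc, F.q_mul_p]
  by_cases h : α = γ
  · subst h
    rw [if_pos rfl, F.q_mul_p]
    by_cases h' : β = b (t α)
    · rw [if_pos h', if_pos ⟨h', rfl⟩, d_p]
    · rw [if_neg h', if_neg fun h => h' h.1, map_zero]
  · rw [if_neg h, if_neg fun h' => h h'.2, mul_zero, map_zero]

theorem isOver_mapHom (ψ : Hom S S') : F.IsOver G ψ (F.mapHom G ψ) := by
  have hp (α) : F.mapHom G ψ (F.p α) = G.p α := by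
    apply G.toMatrix_injective
    rw [toMatrix_mapHom, toMatrix_p, toMatrix_p]
    ext β γ
    simp only [Matrix.map_apply, Matrix.of_apply]
    split_ifs <;> simp [ψ.map_unit]
  have hq (α) : F.mapHom G ψ (F.q α) = G.q α := by
    apply G.toMatrix_injective
    rw [toMatrix_mapHom, toMatrix_q, toMatrix_q]
    ext β γ
    simp only [Matrix.map_apply, Matrix.of_apply]
    split_ifs <;> simp [ψ.map_unit]
  refine ⟨hp, hq, fun x => ?_⟩
  have h1 : F.mapHom G ψ (F.c 1) = G.c 1 := by
    simp only [c_one, map_sum, hp]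
  -- Since `p (b i) = q (b i)`, the piece of an element between two base idempotents is its matrix
  -- entry at `(b i, b j)`, where `mapHom` is known. Summing over `i` and `j` recovers elements of
  -- the corner.
  have key (i j : Fin r) : G.p (b i) * F.mapHom G ψ (F.c x) * G.p (b j) =
      G.p (b i) * G.c (ψ.toAlgHom x) * G.p (b j) := by
    conv_lhs => rw [G.base i, ← c_toMatrix, toMatrix_mapHom, Matrix.map_apply, toMatrix_apply,
      ← F.base, ← F.c_unit, ← F.c_unit, ← F.c_mul, ← F.c_mul, F.d_c]
    rw [map_mul ψ.toAlgHom, map_mul ψ.toAlgHom, ψ.map_unit, ψ.map_unit, G.c_mul, G.c_mul,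
      G.c_unit, G.c_unit]
  calc F.mapHom G ψ (F.c x) = G.c 1 * F.mapHom G ψ (F.c x) * G.c 1 := by
        rw [← h1, ← map_mul, ← map_mul, c_one_mul, c_mul_one]
    _ = G.c 1 * G.c (ψ.toAlgHom x) * G.c 1 := by
        simp_rw [c_one, Finset.sum_mul, Finset.mul_sum, key]
    _ = G.c (ψ.toAlgHom x) := by rw [c_one_mul, c_mul_one]

theorem mapHom_bijective (ψ : Hom S S') (h : Function.Bijective ψ.toAlgHom) :
    Function.Bijective (F.mapHom G ψ) := by
  constructor
  · intro x y hxy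
    apply F.toMatrix_injective
    have := congrArg G.toMatrix hxy
    rw [toMatrix_mapHom, toMatrix_mapHom] at this
    exact Matrix.map_injective h.1 this
  · intro y
    refine ⟨F.ofMatrix ((G.toMatrix y).map (ψ.inverse h).toAlgHom), G.toMatrix_injective ?_⟩
    have hy : ((G.toMatrix y).map (ψ.inverse h).toAlgHom).map ψ.toAlgHom = G.toMatrix y := by
      ext α β
      exact (AlgEquiv.ofBijective ψ.toAlgHom h).apply_symm_apply _
    rw [toMatrix_mapHom, toMatrix_ofMatrix, Matrix.map_mul, Matrix.map_mul, hy,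
      toMatrix_one_map F G ψ, ← toMatrix_mul, ← toMatrix_mul, one_mul, mul_one]

end Frame
end Frames

/-- Membership in the radical yields only a left inverse `z`. But `z = 1 - z * x` has the same
shape, so it has a left inverse too, which must equal its right inverse `x + 1`. -/
theorem isUnit_add_one_of_mem_jacobson_bot {R : Type*} [Ring R] {x : R}
    (hx : x ∈ Ideal.jacobson (⊥ : Ideal R)) : IsUnit (x + 1) := by
  have key {x : R} (hx : x ∈ Ideal.jacobson (⊥ : Ideal R)) : ∃ z, z * (x + 1) = 1 := by
    obtain ⟨z, hz⟩ := Ideal.mem_jacobson_iff.mp hx 1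
    exact ⟨z, by rw [mul_add, mul_one]; simpa [sub_eq_zero] using hz⟩
  obtain ⟨z, hz⟩ := key hx
  obtain ⟨y, hy⟩ := key (neg_mem (Ideal.mul_mem_left _ z hx))
  have hz' : -(z * x) + 1 = z := by
    rw [mul_add, mul_one] at hz
    rw [← hz]
    abel
  rw [hz'] at hy
  have : y = x + 1 := by
    calc y = y * (z * (x + 1)) := by rw [hz, mul_one]
      _ = x + 1 := by rw [← mul_assoc, hy, one_mul]
  exact ⟨⟨x + 1, z, by rw [← this, hy], hz⟩, rfl⟩

/-! ### Complete augmented algebras and morphisms to the tangent algebra -/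

section Complete

variable {k : Type u} [Field k] {r : ℕ}

namespace AugAlg

universe w₁ w₂

variable {S : AugAlg.{u, w} k r}

instance : S.augIdeal.IsTwoSided := inferInstanceAs (RingHom.ker S.aug).IsTwoSided

theorem mem_augIdeal {x : S.carrier} : x ∈ S.augIdeal ↔ S.aug x = 0 := RingHom.mem_ker

theorem sub_unit_aug_mem (x : S.carrier) : x - S.unit (S.aug x) ∈ S.augIdeal := by
  rw [mem_augIdeal, map_sub, S.aug_unit, sub_self]

theorem IsComplete.eq_zero (hS : S.IsComplete) {x : S.carrier} (hx : ∀ n, x ∈ S.augIdeal ^ n) :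
    x = 0 := by
  obtain ⟨y, -, hy⟩ := hS (fun _ => 0) (by simp)
  rw [hy x (by simpa using hx), hy 0 (by simp)]

/-- For `m = -(y * x)` in the ideal, completeness sums the geometric series `∑ m ^ j`, and the sum
is a left inverse of `1 - m = 1 + y * x`. -/
theorem IsComplete.augIdeal_le_jacobson (hS : S.IsComplete) :
    S.augIdeal ≤ Ideal.jacobson (⊥ : Ideal S.carrier) := by
  intro x hx
  rw [Ideal.mem_jacobson_iff]
  intro y
  have hm : -(y * x) ∈ S.augIdeal := neg_mem (Ideal.mul_mem_left _ _ hx)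
  set m := -(y * x) with hmdef
  have hpow (n : ℕ) : m ^ n ∈ S.augIdeal ^ n := by
    induction n with
    | zero => simp [Submodule.pow_zero]
    | succ n ih =>
      rw [pow_succ, Submodule.pow_succ]
      exact Ideal.mul_mem_mul ih hm
  obtain ⟨z, hz, -⟩ := hS (fun n => ∑ j ∈ Finset.range n, m ^ j) (fun n => by
    simpa [Finset.sum_range_succ] using hpow n)
  refine ⟨z, ?_⟩
  rw [Ideal.mem_bot]
  apply hS.eq_zero
  intro n
  have h1 : z * y * x + z - 1 = (z - ∑ j ∈ Finset.range n, m ^ j) * (1 - m) - m ^ n := by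
    have := geom_sum_mul_neg m n
    rw [sub_mul, this, hmdef]
    noncomm_ring
  rw [h1]
  exact sub_mem (Ideal.mul_mem_right _ _ (hz n)) (hpow n)

theorem isComplete_of_pow_eq_bot {n : ℕ} (hn : S.augIdeal ^ n = ⊥) : S.IsComplete := by
  intro s hs
  have hsub (m j : ℕ) : s (m + j) - s m ∈ S.augIdeal ^ m := by
    induction j with
    | zero => simp
    | succ j ih =>
      have := add_mem (Ideal.pow_le_pow_right (Nat.le_add_right m j) (hs (m + j))) ih
      simpa [← add_assoc] using this
  refine ⟨s n, fun m => ?_, fun y hy => ?_⟩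
  · rcases le_total m n with h | h
    · obtain ⟨j, rfl⟩ := Nat.exists_eq_add_of_le h
      exact hsub m j
    · obtain ⟨j, rfl⟩ := Nat.exists_eq_add_of_le h
      have := hsub n j
      rw [hn, Ideal.mem_bot] at this
      rw [← neg_sub, this]
      simp
  · have := hy n
    rwa [hn, Ideal.mem_bot, sub_eq_zero] at this

/-- A morphism from an algebra with nilpotent augmentation ideal to a separated one is surjective
if it is surjective modulo the square of the augmentation ideal. -/
theorem Hom.surjective_of_nilpotent {H : AugAlg.{u, w₁} k r} {S : AugAlg.{u, w₂} k r}
    (ψ : Hom H S) {n : ℕ} (hn : H.augIdeal ^ n = ⊥) (hS : S.IsComplete)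
    (h : ∀ x ∈ S.augIdeal, ∃ y ∈ H.augIdeal, x - ψ.toAlgHom y ∈ S.augIdeal ^ 2) :
    Function.Surjective ψ.toAlgHom := by
  have hmem {y} (hy : y ∈ H.augIdeal) : ψ.toAlgHom y ∈ S.augIdeal := by
    rw [mem_augIdeal, ψ.map_aug]
    exact hy
  -- Surjectivity on the first graded piece implies it on all of them, which are generated by
  -- products of elements of degree one.
  have key (m : ℕ) : ∀ x ∈ S.augIdeal ^ (m + 1), ∃ y ∈ H.augIdeal ^ (m + 1),
      x - ψ.toAlgHom y ∈ S.augIdeal ^ (m + 2) := by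
    induction m with
    | zero => simpa [Submodule.pow_one] using h
    | succ m ih =>
      intro x hx
      rw [Submodule.pow_succ] at hx
      refine Submodule.mul_induction_on hx (fun a ha c hc => ?_) (fun a c ha hc => ?_)
      · obtain ⟨a', ha', ha''⟩ := ih a ha
        obtain ⟨c', hc', hc''⟩ := h c hc
        refine ⟨a' * c', ?_, ?_⟩
        · rw [Submodule.pow_succ]
          exact Ideal.mul_mem_mul ha' hc'
        · have : a * c - ψ.toAlgHom (a' * c') =
              (a - ψ.toAlgHom a') * ψ.toAlgHom c' + a * (c - ψ.toAlgHom c') := by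
            rw [map_mul]
            noncomm_ring
          rw [this]
          refine add_mem ?_ ?_
          · rw [Submodule.pow_succ (n := m + 2)]
            exact Ideal.mul_mem_mul ha'' (hmem hc')
          · rw [show m + 1 + 2 = m + 1 + 2 from rfl, Ideal.IsTwoSided.pow_add]
            exact Ideal.mul_mem_mul ha hc''
      · obtain ⟨a', ha', ha''⟩ := ha
        obtain ⟨c', hc', hc''⟩ := hc
        refine ⟨a' + c', add_mem ha' hc', ?_⟩
        rw [map_add, add_sub_add_comm]
        exact add_mem ha'' hc''
  -- Beyond degree `n` the approximating elements of `H` vanish, so this power of the ideal of `S`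
  -- lies in all higher ones and is zero by separatedness.
  have hzero : S.augIdeal ^ (n + 1) = ⊥ := by
    have hle (j : ℕ) : S.augIdeal ^ (n + 1) ≤ S.augIdeal ^ (n + 1 + j) := by
      induction j with
      | zero => exact le_rfl
      | succ j ih =>
        refine ih.trans fun x hx => ?_
        rw [show n + 1 + j = n + j + 1 by ring] at hx
        obtain ⟨y, hy, hxy⟩ := key (n + j) x hx
        have hy0 : y = 0 := by
          have := Ideal.pow_le_pow_right (show n ≤ n + j + 1 by omega) hy
          rwa [hn, Ideal.mem_bot] at this
        rw [hy0, map_zero, sub_zero] at hxy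
        rwa [show n + 1 + (j + 1) = n + j + 2 by ring]
    rw [eq_bot_iff]
    intro x hx
    exact hS.eq_zero fun m => Ideal.pow_le_pow_right (by omega) (hle m hx)
  have hall (m : ℕ) : ∀ x ∈ S.augIdeal, ∃ y, x - ψ.toAlgHom y ∈ S.augIdeal ^ (m + 1) := by
    intro x hx
    induction m with
    | zero => exact ⟨0, by simpa [Submodule.pow_one] using hx⟩
    | succ m ih =>
      obtain ⟨y, hy⟩ := ih
      obtain ⟨z, -, hz⟩ := key m _ hy
      exact ⟨y + z, by rwa [map_add, ← sub_sub]⟩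
  intro x
  obtain ⟨y, hy⟩ := hall n _ (sub_unit_aug_mem x)
  rw [hzero, Ideal.mem_bot, sub_eq_zero, sub_eq_iff_eq_add] at hy
  exact ⟨y + H.unit (S.aug x), by rw [map_add, ψ.map_unit, ← hy]⟩

/-- An augmented algebra in a larger universe. -/
def ulift (S : AugAlg.{u, w₁} k r) : AugAlg.{u, max w₁ w₂} k r where
  carrier := ULift.{w₂} S.carrier
  unit := (ULift.algEquiv (R := k)).symm.toAlgHom.comp S.unit
  aug := S.aug.comp (ULift.algEquiv (R := k)).toAlgHom
  aug_unit c := S.aug_unit c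

/-- The identification of an augmented algebra with its lift. -/
def upHom (S : AugAlg.{u, w₁} k r) : Hom S (ulift.{u, w₁, w₂} S) where
  toAlgHom := (ULift.algEquiv (R := k)).symm.toAlgHom
  map_unit _ := rfl
  map_aug _ := rfl

theorem upHom_injective (S : AugAlg.{u, w₁} k r) :
    Function.Injective (upHom.{u, w₁, w₂} S).toAlgHom :=
  (ULift.algEquiv (R := k)).symm.injective

theorem ulift_isIso (S : AugAlg.{u, w₁} k r) : (ulift.{u, w₁, w₂} S).IsIso S :=
  ⟨{ toAlgHom := (ULift.algEquiv (R := k)).toAlgHom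
     map_unit := fun _ => rfl
     map_aug := fun _ => rfl }, (ULift.algEquiv (R := k)).bijective⟩

theorem tangent_mul_eq_zero {x y : (tangent k r).carrier} (hx : x ∈ (tangent k r).augIdeal)
    (hy : y ∈ (tangent k r).augIdeal) : x * y = 0 := by
  have key {x : (tangent k r).carrier} (hx : x ∈ (tangent k r).augIdeal) (i j : Fin r) :
      TrivSqZeroExt.fst (x.1 i j) = 0 := by
    by_cases h : i = j
    · subst h
      exact congrFun (mem_augIdeal.mp hx) i
    · exact x.2 i j h
  apply Subtype.ext
  change x.1 * y.1 = 0
  ext i j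
  · simp [Matrix.mul_apply, TrivSqZeroExt.fst_sum, key hx]
  · simp [Matrix.mul_apply, TrivSqZeroExt.snd_sum, key hx, key hy]

theorem IsIso.mul_eq_zero {S : AugAlg.{u, w} k r} (h : S.IsIso (tangent k r)) {x y : S.carrier}
    (hx : x ∈ S.augIdeal) (hy : y ∈ S.augIdeal) : x * y = 0 := by
  obtain ⟨f, hf⟩ := h
  apply hf.1
  rw [map_mul, map_zero]
  exact tangent_mul_eq_zero (by rw [mem_augIdeal, f.map_aug]; exact hx)
    (by rw [mem_augIdeal, f.map_aug]; exact hy)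

theorem unit_single_mul_unit (S : AugAlg.{u, w} k r) (c : Fin r → k) (i : Fin r) :
    S.unit (Pi.single i 1) * S.unit c = c i • S.unit (Pi.single i 1) := by
  rw [← map_mul, ← map_smul]
  congr 1
  ext j
  by_cases h : j = i
  · subst h; simp
  · simp [h]

theorem unit_mul_unit_single (S : AugAlg.{u, w} k r) (c : Fin r → k) (i : Fin r) :
    S.unit c * S.unit (Pi.single i 1) = c i • S.unit (Pi.single i 1) := by
  rw [← unit_single_mul_unit, ← map_mul, ← map_mul, mul_comm]

theorem sum_unit_single (S : AugAlg.{u, w} k r) : ∑ i, S.unit (Pi.single i 1) = 1 := by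
  rw [← map_sum, Finset.univ_sum_single]
  exact map_one S.unit

/-- The entries of the morphism to the tangent algebra given by a linear form. -/
def tangentEntry (S : AugAlg.{u, w} k r) (ξ : S.carrier →ₗ[k] k) (x : S.carrier) (i j : Fin r) :
    DualNumber k :=
  TrivSqZeroExt.inl (if i = j then S.aug x i else 0) + TrivSqZeroExt.inr
    (ξ (S.unit (Pi.single i 1) * (x - S.unit (S.aug x)) * S.unit (Pi.single j 1)))

@[simp]
theorem fst_tangentEntry (S : AugAlg.{u, w} k r) (ξ : S.carrier →ₗ[k] k) (x : S.carrier)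
    (i j : Fin r) :
    TrivSqZeroExt.fst (tangentEntry S ξ x i j) = if i = j then S.aug x i else 0 := by
  simp [tangentEntry]

@[simp]
theorem snd_tangentEntry (S : AugAlg.{u, w} k r) (ξ : S.carrier →ₗ[k] k) (x : S.carrier)
    (i j : Fin r) :
    TrivSqZeroExt.snd (tangentEntry S ξ x i j) =
      ξ (S.unit (Pi.single i 1) * (x - S.unit (S.aug x)) * S.unit (Pi.single j 1)) := by
  simp [tangentEntry]

/-- The matrix over the dual numbers given by a linear form that vanishes on the square of the
augmentation ideal. -/
def tangentMatrix (S : AugAlg.{u, w} k r) (ξ : S.carrier →ₗ[k] k)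
    (hξ : ∀ x ∈ S.augIdeal, ∀ y ∈ S.augIdeal, ξ (x * y) = 0) :
    S.carrier →ₐ[k] Matrix (Fin r) (Fin r) (DualNumber k) := AlgHom.ofLinearMap
    { toFun := fun x => Matrix.of (tangentEntry S ξ x)
      map_add' := by
        intro x y
        ext i j
        · by_cases h : i = j <;> simp [h]
        · simp only [Matrix.add_apply, Matrix.of_apply, snd_tangentEntry, TrivSqZeroExt.snd_add]
          rw [← map_add, map_add, map_add, ← add_mul, ← mul_add, add_sub_add_comm]
      map_smul' := by
        intro c x
        ext i j
        · by_cases h : i = j <;> simp [h]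
        · simp only [Matrix.smul_apply, Matrix.of_apply, snd_tangentEntry,
            TrivSqZeroExt.snd_smul, RingHom.id_apply]
          rw [← map_smul, map_smul, map_smul, ← smul_sub, mul_smul_comm, smul_mul_assoc] }
    (by
      ext i j <;> by_cases h : i = j <;> simp [Matrix.one_apply, h])
    (by
      intro x y
      ext i j
      · by_cases h : i = j <;> simp [Matrix.mul_apply, TrivSqZeroExt.fst_sum, h]
      -- Leibniz rule: split `x` and `y` into scalar and augmentation parts. The last summand is a
      -- product of two elements of the augmentation ideal, which `ξ` kills.
      · have h : S.unit (Pi.single i 1) * (x * y - S.unit (S.aug (x * y))) *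
            S.unit (Pi.single j 1) =
            S.aug x i • (S.unit (Pi.single i 1) * (y - S.unit (S.aug y)) * S.unit (Pi.single j 1))
            + S.aug y j • (S.unit (Pi.single i 1) * (x - S.unit (S.aug x)) *
              S.unit (Pi.single j 1))
            + (S.unit (Pi.single i 1) * (x - S.unit (S.aug x))) *
              ((y - S.unit (S.aug y)) * S.unit (Pi.single j 1)) := by
          rw [← smul_mul_assoc, ← smul_mul_assoc, ← unit_single_mul_unit, ← mul_smul_comm,
            ← unit_mul_unit_single, map_mul, map_mul]
          noncomm_ring
        simp only [LinearMap.coe_mk, AddHom.coe_mk, Matrix.mul_apply,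
          Matrix.of_apply, snd_tangentEntry, TrivSqZeroExt.snd_sum, TrivSqZeroExt.snd_mul,
          fst_tangentEntry]
        rw [h, map_add, map_add, map_smul, map_smul,
          hξ _ (Ideal.mul_mem_left _ _ (sub_unit_aug_mem x)) _
            (Ideal.mul_mem_right _ _ (sub_unit_aug_mem y)), add_zero, Finset.sum_add_distrib]
        simp [mul_comm])

theorem tangentMatrix_apply (S : AugAlg.{u, w} k r) (ξ : S.carrier →ₗ[k] k)
    (hξ : ∀ x ∈ S.augIdeal, ∀ y ∈ S.augIdeal, ξ (x * y) = 0) (x : S.carrier) (i j : Fin r) :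
    tangentMatrix S ξ hξ x i j = tangentEntry S ξ x i j := rfl

/-- The morphism to the tangent algebra given by a linear form that vanishes on the square of the
augmentation ideal. -/
def tangentHom (S : AugAlg.{u, w} k r) (ξ : S.carrier →ₗ[k] k)
    (hξ : ∀ x ∈ S.augIdeal, ∀ y ∈ S.augIdeal, ξ (x * y) = 0) : Hom S (tangent k r) where
  toAlgHom := (tangentMatrix S ξ hξ).codRestrict (tangentSubalgebra k r) fun x i j hij => by
    simp [tangentMatrix_apply, hij]
  map_unit c := by
    apply Subtype.ext
    change tangentMatrix S ξ hξ (S.unit c) = Matrix.diagonal fun i => TrivSqZeroExt.inl (c i)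
    ext i j
    · by_cases h : i = j <;> simp [tangentMatrix_apply, h, S.aug_unit]
    · by_cases h : i = j <;> simp [tangentMatrix_apply, h, S.aug_unit]
  map_aug x := by
    funext i
    change TrivSqZeroExt.fst (tangentMatrix S ξ hξ x i i) = S.aug x i
    simp [tangentMatrix_apply]

/-- A linear form that vanishes on the square of the ideal but not at `x` defines a morphism to the
tangent algebra; its `(i, j)` entry at `x` is the form on the Peirce component of `x`, and these
components sum to `x`. -/
theorem IsComplete.mem_sq_of_forall_hom {x : S.carrier} (hx : x ∈ S.augIdeal)
    (h : ∀ ψ : Hom S (tangent k r), ψ.toAlgHom x = 0) : x ∈ S.augIdeal ^ 2 := by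
  by_contra hx2
  obtain ⟨ξ, hξx, hξ⟩ := Submodule.exists_dual_map_eq_bot_of_notMem
    (p := (S.augIdeal ^ 2).restrictScalars k) hx2 inferInstance
  have hξ0 : ∀ y ∈ S.augIdeal ^ 2, ξ y = 0 := fun y hy => by
    have : ξ y ∈ Submodule.map ξ ((S.augIdeal ^ 2).restrictScalars k) := ⟨y, hy, rfl⟩
    rwa [hξ, Submodule.mem_bot] at this
  have hψ := h (tangentHom S ξ fun x hx y hy => hξ0 _ (by
    rw [Submodule.pow_succ, Submodule.pow_one]
    exact Ideal.mul_mem_mul hx hy))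
  have hij (i j : Fin r) : ξ (S.unit (Pi.single i 1) * x * S.unit (Pi.single j 1)) = 0 := by
    have h1 := congrArg (fun z => TrivSqZeroExt.snd (z.1 i j)) hψ
    change TrivSqZeroExt.snd (tangentEntry S ξ x i j) = 0 at h1
    rwa [snd_tangentEntry, mem_augIdeal.mp hx, map_zero, sub_zero] at h1
  apply hξx
  calc ξ x = ξ ((∑ i, S.unit (Pi.single i 1)) * x * ∑ j, S.unit (Pi.single j 1)) := by
        rw [sum_unit_single, one_mul, mul_one]
    _ = 0 := by simp [Finset.sum_mul, Finset.mul_sum, hij]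

end AugAlg
end Complete

section FrameUnits
variable {k : Type u} [Field k] {r : ℕ} {ι : Type*} [Fintype ι] [DecidableEq ι]
universe w₁
/-- An element of an algebra with frame over a complete algebra is a unit if its matrix reduces to
that of the identity. -/
theorem Frame.isUnit_of_toMatrix {S : AugAlg.{u, w₁} k r} {t : ι → Fin r} {b : Fin r → ι}
    {B : Type*} [Ring B] [Algebra k B] (F : Frame S t b B) (hS : S.IsComplete) {x : B}
    (hx : ∀ α β, S.aug (F.toMatrix x α β) = S.aug (F.toMatrix 1 α β)) : IsUnit x := by
  -- `toMatrix x` need not be invertible in the full matrix ring, because `toMatrix 1` is only an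
  -- idempotent. The matrix inverted is `toMatrix x - toMatrix 1 + 1`, and `ofMatrix` carries its
  -- inverse back to `B`.
  have hmem : F.toMatrix x - F.toMatrix 1 ∈ Ideal.jacobson (⊥ : Ideal (Matrix ι ι S.carrier)) := by
    have h := Ideal.matrix_jacobson_le (n := ι) (⊥ : Ideal S.carrier)
    rw [Ideal.matrix_bot] at h
    refine h fun α β => hS.augIdeal_le_jacobson ?_
    rw [mem_augIdeal, Matrix.sub_apply, map_sub, hx, sub_self]
  obtain ⟨s, hs⟩ := isUnit_add_one_of_mem_jacobson_bot hmem
  have h1 : x * F.ofMatrix ↑s⁻¹ = 1 := by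
    rw [mul_ofMatrix, ← F.ofMatrix_one, ← s.mul_inv, hs, add_mul, sub_mul, map_add, map_sub,
      ← mul_ofMatrix, ← mul_ofMatrix, one_mul, one_mul, sub_add_cancel]
  have h2 : F.ofMatrix ↑s⁻¹ * x = 1 := by
    rw [ofMatrix_mul, ← F.ofMatrix_one, ← s.inv_mul, hs, mul_add, mul_sub, map_add, map_sub,
      ← ofMatrix_mul, ← ofMatrix_mul, mul_one, mul_one, sub_add_cancel]
  exact ⟨⟨x, F.ofMatrix ↑s⁻¹, h1, h2⟩, rfl⟩
end FrameUnits

/-! ### Coordinates on `M` and the standard frame of `End_S (S ⊗ M)` -/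

section Coordinates

variable {k : Type u} [Field k] {r : ℕ} {ι : Type*} [Fintype ι] [DecidableEq ι]

/-- Coordinates on `M = ⊕ M i`, that is, the union of bases of the `M i`. -/
structure Coordinates (t : ι → Fin r) (M : Fin r → Type v)
    [∀ i, AddCommGroup (M i)] [∀ i, Module k (M i)] where
  vec : ι → ∀ i, M i
  coord : ι → (∀ i, M i) →ₗ[Fin r → k] (Fin r → k)
  coord_vec : ∀ α β, coord α (vec β) = if α = β then Pi.single (t α) 1 else 0
  sum_coord_smul_vec : ∀ m, ∑ α, coord α m • vec α = m

/-- The coordinates given by bases of the `M i`. -/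
noncomputable def coordinatesOfFinite (M : Fin r → Type v)
    [∀ i, AddCommGroup (M i)] [∀ i, Module k (M i)] [∀ i, Module.Finite k (M i)] :
    Coordinates (k := k) (ι := Σ i, Fin (Module.finrank k (M i))) Sigma.fst M where
  vec α := Pi.single α.1 (Module.finBasis k (M α.1) α.2)
  coord α :=
    { toFun := fun m => Pi.single α.1 ((Module.finBasis k (M α.1)).repr (m α.1) α.2)
      map_add' := fun m m' => by simp [Pi.single_add]
      map_smul' := fun c m => by
        funext j
        by_cases h : j = α.1
        · subst h; simp
        · simp [h] }
  coord_vec α β := by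
    obtain ⟨i, a⟩ := α
    obtain ⟨j, b⟩ := β
    by_cases h : i = j
    · subst h
      by_cases h' : a = b
      · subst h'
        simp
      · simp [h']
    · have : (⟨i, a⟩ : Σ i, Fin (Module.finrank k (M i))) ≠ ⟨j, b⟩ := fun h' => h (by
        injection h')
      simp [this, h]
  sum_coord_smul_vec m := by
    funext j
    rw [Fintype.sum_sigma, Finset.sum_apply, Finset.sum_eq_single j]
    · rw [Finset.sum_apply]
      conv_rhs => rw [← (Module.finBasis k (M j)).sum_repr (m j)]
      refine Finset.sum_congr rfl fun a _ => ?_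
      simp
    · intro i _ h
      rw [Finset.sum_apply]
      refine Finset.sum_eq_zero fun a _ => ?_
      simp [h.symm]
    · simp

variable {M : Fin r → Type v} [∀ i, AddCommGroup (M i)] [∀ i, Module k (M i)]

/-- The contraction of `S ⊗ M` with a linear form on `M`. -/
noncomputable def contract (S : AugAlg.{u, w} k r) (l : (∀ i, M i) →ₗ[Fin r → k] (Fin r → k)) :
    Induced S M →ₗ[S.carrier] S.carrier where
  toFun := TensorProduct.liftAddHom
    { toFun := fun s =>
        { toFun := fun m => s * S.unit (l m)
          map_zero' := by simp
          map_add' := by intro m m'; simp [mul_add] }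
      map_zero' := by ext m; simp
      map_add' := by intro s s'; ext m; simp [add_mul] }
    (by
      intro c s m
      change s * S.unit c * S.unit (l m) = s * S.unit (l (c • m))
      rw [map_smul, smul_eq_mul, map_mul, mul_assoc])
  map_add' := map_add _
  map_smul' s z := by
    induction z using TensorProduct.induction_on with
    | zero => simp
    | tmul y m => simp [TensorProduct.smul_tmul', mul_assoc]
    | add y z hy hz => simp only [smul_add, map_add, hy, hz]

theorem contract_tmul (S : AugAlg.{u, w} k r) (l : (∀ i, M i) →ₗ[Fin r → k] (Fin r → k))
    (s : S.carrier) (m : ∀ i, M i) : contract S l (s ⊗ₜ m) = s * S.unit (l m) := rfl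

theorem idTensor_tmul (S : AugAlg.{u, w} k r) (f : (∀ i, M i) →ₗ[Fin r → k] (∀ i, M i))
    (s : S.carrier) (m : ∀ i, M i) : idTensor M S f (s ⊗ₜ m) = s ⊗ₜ f m := rfl

namespace Coordinates

variable {t : ι → Fin r} {b : Fin r → ι} (X : Coordinates (k := k) t M)

theorem coord_mul_single (α : ι) (m : ∀ i, M i) :
    X.coord α m * Pi.single (t α) 1 = X.coord α m := by
  conv_rhs => rw [← X.sum_coord_smul_vec m, map_sum]
  simp [X.coord_vec]

theorem single_smul_vec (α : ι) : (Pi.single (t α) 1 : Fin r → k) • X.vec α = X.vec α := by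
  conv_rhs => rw [← X.sum_coord_smul_vec (X.vec α)]
  simp [X.coord_vec]

theorem single_mul_coord (α : ι) (i : Fin r) (m : ∀ i, M i) :
    Pi.single i 1 * X.coord α m = if t α = i then X.coord α m else 0 := by
  split_ifs with h
  · rw [← h, mul_comm, coord_mul_single]
  · rw [← coord_mul_single, mul_comm, mul_assoc]
    rw [← Pi.single_mul_right]
    simp [h]

/-- The endomorphism `m ↦ coord α m • vec β` of `M`. -/
def elementary (α β : ι) : (∀ i, M i) →ₗ[Fin r → k] (∀ i, M i) :=
  (X.coord α).smulRight (X.vec β)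

theorem elementary_apply (α β : ι) (m : ∀ i, M i) :
    X.elementary α β m = X.coord α m • X.vec β := rfl

/-- The standard matrix units in `End_S (S ⊗ M)`. -/
noncomputable def matrixUnits (htb : ∀ i, t (b i) = i) (S : AugAlg.{u, w} k r) :
    MatrixUnits t b (EndInduced S M) where
  -- In the opposite ring a product applies its left factor first: `p α` takes the vector `α` to the
  -- base vector of its block, and `q α` takes it back.
  p α := MulOpposite.op (idTensor M S (X.elementary α (b (t α))))
  q α := MulOpposite.op (idTensor M S (X.elementary (b (t α)) α))
  base i := by rw [htb]
  q_mul_p α β := by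
    refine MulOpposite.unop_injective (induced_hom_ext fun m => ?_)
    change idTensor M S _ (idTensor M S _ _) = _
    rw [idTensor_tmul, idTensor_tmul, elementary_apply, elementary_apply, map_smul, X.coord_vec]
    by_cases h : α = β
    · subst h
      rw [if_pos rfl, if_pos rfl]
      change _ = idTensor M S _ _
      rw [idTensor_tmul, elementary_apply, htb, smul_assoc]
      congr 2
      simpa [htb] using X.single_smul_vec (b (t α))
    · rw [if_neg (Ne.symm h), if_neg h]
      simp
  sum_p_mul_q := by
    refine MulOpposite.unop_injective (induced_hom_ext fun m => ?_)
    rw [Finset.unop_sum, LinearMap.sum_apply]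
    change ∑ α, idTensor M S (X.elementary (b (t α)) α) (idTensor M S _ _) = (1 : S.carrier) ⊗ₜ m
    conv_rhs => rw [← X.sum_coord_smul_vec m, TensorProduct.tmul_sum]
    refine Finset.sum_congr rfl fun α _ => ?_
    rw [idTensor_tmul, idTensor_tmul, elementary_apply, elementary_apply, map_smul, X.coord_vec,
      if_pos rfl, htb, smul_assoc, X.single_smul_vec]

/-- The linear form on `M` that sums the base coordinates. -/
def baseForm (b : Fin r → ι) : (∀ i, M i) →ₗ[Fin r → k] (Fin r → k) := ∑ i, X.coord (b i)

/-- The sum of the base vectors. -/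
def baseVec (b : Fin r → ι) : ∀ i, M i := ∑ i, X.vec (b i)

theorem baseForm_vec (htb : ∀ i, t (b i) = i) (i : Fin r) :
    X.baseForm b (X.vec (b i)) = Pi.single i 1 := by
  have hb : Function.Injective b := Function.LeftInverse.injective htb
  simp [baseForm, X.coord_vec, hb.eq_iff, htb]

theorem baseForm_baseVec (htb : ∀ i, t (b i) = i) : X.baseForm b (X.baseVec b) = 1 := by
  rw [baseVec, map_sum]
  simp_rw [X.baseForm_vec htb]
  exact Finset.univ_sum_single 1

theorem single_smul_baseVec (htb : ∀ i, t (b i) = i) (i : Fin r) :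
    (Pi.single i 1 : Fin r → k) • X.baseVec b = X.vec (b i) := by
  rw [baseVec, Finset.smul_sum, Finset.sum_eq_single i]
  · simpa [htb] using X.single_smul_vec (b i)
  · intro j _ h
    rw [← X.single_smul_vec, ← mul_smul, htb, ← Pi.single_mul_left]
    simp [h.symm]
  · simp

theorem single_mul_baseForm (htb : ∀ i, t (b i) = i) (i : Fin r) (m : ∀ i, M i) :
    Pi.single i 1 * X.baseForm b m = X.coord (b i) m := by
  rw [baseForm, LinearMap.sum_apply, Finset.mul_sum]
  simp [single_mul_coord, htb]

/-- The standard frame of `End_S (S ⊗ M)`. -/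
noncomputable def frame (htb : ∀ i, t (b i) = i) (S : AugAlg.{u, w} k r) :
    Frame S t b (EndInduced S M) where
  toMatrixUnits := X.matrixUnits htb S
  -- The base vectors span a copy of `k^r` in `M`, so `S ⊗ k^r = S` is a direct summand of `S ⊗ M`.
  -- Its endomorphisms are the right multiplications by elements of `S`; `c` extends these by zero
  -- and `d` reads them off.
  c :=
    { toFun := fun s => MulOpposite.op ((LinearMap.toSpanSingleton S.carrier (Induced S M)
        (s • ((1 : S.carrier) ⊗ₜ X.baseVec b))) ∘ₗ contract S (X.baseForm b))
      map_add' := fun x y => by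
        refine MulOpposite.unop_injective (induced_hom_ext fun m => ?_)
        simp [add_smul]
      map_smul' := fun c x => by
        refine MulOpposite.unop_injective (induced_hom_ext fun m => ?_)
        simpa using smul_comm _ _ _ }
  d :=
    { toFun := fun f => contract S (X.baseForm b) (f.unop ((1 : S.carrier) ⊗ₜ X.baseVec b))
      map_add' := fun x y => by simp
      map_smul' := fun c x => by
        simp }
  c_mul x y := by
    refine MulOpposite.unop_injective (induced_hom_ext fun m => ?_)
    simp [contract_tmul, X.baseForm_baseVec htb, mul_smul]
  d_c x := by simp [contract_tmul, X.baseForm_baseVec htb]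
  c_d y := by
    refine MulOpposite.unop_injective (induced_hom_ext fun m => ?_)
    simp [contract_tmul]
  c_unit i := by
    refine MulOpposite.unop_injective (induced_hom_ext fun m => ?_)
    have h : (Pi.single i 1 : Fin r → k) * Pi.single i 1 = Pi.single i 1 := by
      rw [← Pi.single_mul, one_mul]
    change _ = idTensor M S _ _
    rw [idTensor_tmul, elementary_apply, htb, ← X.single_mul_baseForm htb, mul_comm, mul_smul,
      ← unit_smul_tmul, ← X.single_smul_baseVec htb, ← mul_smul, h, ← unit_smul_tmul]
    simp [contract_tmul]

variable (htb : ∀ i, t (b i) = i)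

theorem frame_p (S : AugAlg.{u, w} k r) (α : ι) :
    (X.frame htb S).p α = MulOpposite.op (idTensor M S (X.elementary α (b (t α)))) := rfl

theorem frame_q (S : AugAlg.{u, w} k r) (α : ι) :
    (X.frame htb S).q α = MulOpposite.op (idTensor M S (X.elementary (b (t α)) α)) := rfl

theorem frame_c_one_tmul (S : AugAlg.{u, w} k r) (s : S.carrier) (m : ∀ i, M i) :
    ((X.frame htb S).c s).unop ((1 : S.carrier) ⊗ₜ m) =
      (S.unit (X.baseForm b m) * s) • ((1 : S.carrier) ⊗ₜ X.baseVec b) := by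
  simp [frame, contract_tmul, mul_smul]

theorem isOver_extend {H : AugAlg.{u, w} k r} {S : AugAlg.{u, w'} k r} (ψ : Hom H S) :
    (X.frame htb H).IsOver (X.frame htb S) ψ (extend M ψ) where
  map_p α := by rw [frame_p, frame_p, extend_idTensor]
  map_q α := by rw [frame_q, frame_q, extend_idTensor]
  map_c x := by
    refine MulOpposite.unop_injective (induced_hom_ext fun m => ?_)
    rw [unop_extend_one_tmul, frame_c_one_tmul, frame_c_one_tmul, Hom.tensor_smul,
      Hom.tensor_tmul, map_mul, map_one, ψ.map_unit]

include X htb in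
/-- An endomorphism of `S ⊗ M` that reduces to the identity of `M` is an automorphism if `S` is
complete. -/
theorem isUnit_of_extend_eq_one {S : AugAlg.{u, w} k r} (hS : S.IsComplete) {x : EndInduced S M}
    (hx : extend M S.augHom x = 1) : IsUnit x := by
  refine (X.frame htb S).isUnit_of_toMatrix hS fun α β => ?_
  have h := (X.isOver_extend htb S.augHom).toMatrix x
  have h' := (X.isOver_extend htb S.augHom).toMatrix 1
  rw [hx] at h
  rw [map_one] at h'
  exact congrFun (congrFun (h.symm.trans h') α) β

/-- The identification of `k^r ⊗ M` with `M`. -/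
noncomputable def collapse (z : Induced (base k r) M) : ∀ i, M i :=
  ∑ α, (show Fin r → k from contract (base k r) (X.coord α) z) • X.vec α

theorem collapse_one_tmul (m : ∀ i, M i) :
    X.collapse ((1 : (base k r).carrier) ⊗ₜ m) = m := by
  conv_rhs => rw [← X.sum_coord_smul_vec m]
  refine Finset.sum_congr rfl fun α _ => ?_
  rw [contract_tmul, one_mul]
  rfl

theorem collapse_add (z z' : Induced (base k r) M) :
    X.collapse (z + z') = X.collapse z + X.collapse z' := by
  rw [collapse, collapse, collapse, ← Finset.sum_add_distrib]
  refine Finset.sum_congr rfl fun α _ => ?_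
  rw [map_add]
  exact add_smul (R := Fin r → k) (contract (base k r) (X.coord α) z)
    (contract (base k r) (X.coord α) z') (X.vec α)

theorem collapse_smul (c : Fin r → k) (z : Induced (base k r) M) :
    X.collapse ((show (base k r).carrier from c) • z) = c • X.collapse z := by
  rw [collapse, collapse, Finset.smul_sum]
  refine Finset.sum_congr rfl fun α _ => ?_
  rw [map_smul]
  exact mul_smul (α := Fin r → k) c (contract (base k r) (X.coord α) z) (X.vec α)

theorem one_tmul_collapse (z : Induced (base k r) M) :
    (1 : (base k r).carrier) ⊗ₜ[Fin r → k] X.collapse z = z := by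
  induction z using TensorProduct.induction_on with
  | zero =>
    have : X.collapse (0 : Induced (base k r) M) = 0 := by
      simpa using X.collapse_one_tmul 0
    rw [this]
    exact TensorProduct.tmul_zero (∀ i, M i) (1 : (base k r).carrier)
  | tmul y m =>
    have h : y ⊗ₜ[Fin r → k] m = y • ((1 : (base k r).carrier) ⊗ₜ m) := by
      rw [TensorProduct.smul_tmul', smul_eq_mul, mul_one]
    have h' : X.collapse (y ⊗ₜ[Fin r → k] m) = (show Fin r → k from y) • m := by
      rw [h]
      exact (X.collapse_smul y _).trans (congrArg _ (X.collapse_one_tmul m))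
    rw [h', h]
    exact (unit_smul_tmul M (base k r) y m).symm
  | add y z hy hz => rw [collapse_add, TensorProduct.tmul_add, hy, hz]

end Coordinates

end Coordinates

/-! ### Simple modules over artinian rings and Schur's lemma -/

section SimpleModules

/-- An artinian ring has finitely many simple modules. -/
theorem exists_simple_modules (R : Type v) [Ring R] [IsArtinianRing R] :
    ∃ (r : ℕ) (M : Fin r → Type v) (_ : ∀ i, AddCommGroup (M i)) (_ : ∀ i, Module R (M i)),
      (∀ i, IsSimpleModule R (M i)) ∧ (∀ i j, Nonempty (M i ≃ₗ[R] M j) → i = j) ∧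
      ∀ (N : Type v) [AddCommGroup N] [Module R N] [IsSimpleModule R N],
        ∃ i, Nonempty (N ≃ₗ[R] M i) := by
  have hss : IsSemisimpleModule R (R ⧸ Ring.jacobson R) :=
    (IsArtinian.isSemisimpleModule_iff_jacobson R _).mpr (Module.jacobson_quotient_jacobson R R)
  have hN : IsNoetherian R (R ⧸ Ring.jacobson R) := inferInstance
  have hfin : Finite (isotypicComponents R (R ⧸ Ring.jacobson R)) := inferInstance
  obtain ⟨r, ⟨e⟩⟩ := Finite.exists_equiv_fin (isotypicComponents R (R ⧸ Ring.jacobson R))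
  -- The simple modules are indexed by the isotypic components of the semisimple module `R / J`,
  -- with one simple submodule chosen for each.
  choose N hN hNc using fun c : isotypicComponents R (R ⧸ Ring.jacobson R) => c.2
  refine ⟨r, fun i => N (e.symm i), fun i => inferInstance, fun i => inferInstance,
    fun i => hN _, fun i j ⟨f⟩ => ?_, fun L _ _ _ => ?_⟩
  · apply e.symm.injective
    apply Subtype.ext
    rw [hNc, hNc, f.isotypicComponent_eq]
  -- The radical annihilates a simple `L`, so a nonzero vector makes `L` a quotient of `R / J`, and
  -- by semisimplicity a submodule of it.
  · have hL : ∃ S : Submodule R (R ⧸ Ring.jacobson R), Nonempty (L ≃ₗ[R] S) := by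
      have := IsSimpleModule.nontrivial R L
      obtain ⟨x, hx⟩ := exists_ne (0 : L)
      have hle : Ring.jacobson R ≤ LinearMap.ker (LinearMap.toSpanSingleton R L x) := fun a ha => by
        have := IsSemisimpleModule.jacobson_le_annihilator R L ha
        exact Module.mem_annihilator.mp this x
      refine LinearMap.linearEquiv_of_ne_zero
        (f := (Ring.jacobson R).liftQ (LinearMap.toSpanSingleton R L x) hle) fun h => hx ?_
      have h1 := LinearMap.congr_fun h (Submodule.Quotient.mk 1)
      rwa [Submodule.liftQ_apply, LinearMap.toSpanSingleton_apply, one_smul] at h1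
    obtain ⟨S, ⟨f⟩⟩ := hL
    have hS : IsSimpleModule R S := IsSimpleModule.congr f.symm
    let c : isotypicComponents R (R ⧸ Ring.jacobson R) :=
      ⟨isotypicComponent R (R ⧸ Ring.jacobson R) S, S, hS, rfl⟩
    refine ⟨e c, ?_⟩
    change Nonempty (L ≃ₗ[R] N (e.symm (e c)))
    rw [e.symm_apply_apply]
    have h1 : S ≤ isotypicComponent R (R ⧸ Ring.jacobson R) (N c) := by
      rw [← hNc c]
      exact S.le_isotypicComponent
    have := hN c
    obtain ⟨g⟩ := isIsotypicOfType_submodule_iff.mp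
      (IsIsotypicOfType.isotypicComponent R (R ⧸ Ring.jacobson R) (N c)) S h1
    exact ⟨f.trans g⟩

/-- Distinct simple modules: an endomorphism of their direct sum is given by scalars. -/
theorem exists_smul_of_end {k : Type u} [Field k] [IsAlgClosed k] {R : Type w} [Ring R]
    [Algebra k R] {r : ℕ} {M : Fin r → Type v} [∀ i, AddCommGroup (M i)] [∀ i, Module k (M i)]
    [∀ i, Module R (M i)] [∀ i, IsScalarTower k R (M i)] [∀ i, Module.Finite k (M i)]
    (hs : ∀ i, IsSimpleModule R (M i)) (hd : ∀ i j, Nonempty (M i ≃ₗ[R] M j) → i = j)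
    (φ : Module.End R (∀ i, M i)) : ∃ c : Fin r → k, ∀ m, φ m = c • m := by
  have hscal (i : Fin r) : ∃ c : k, ∀ x : M i, φ (Pi.single i x) i = c • x := by
    have := (hs i).nontrivial
    let f : M i →ₗ[R] M i := LinearMap.proj i ∘ₗ φ ∘ₗ LinearMap.single R M i
    obtain ⟨c, hc⟩ := Module.End.exists_eigenvalue (f.restrictScalars k)
    obtain ⟨x, hx⟩ := hc.exists_hasEigenvector
    refine ⟨c, fun y => ?_⟩
    -- An eigenvector prevents `f - c` from being injective, so it is zero by Schur's lemma.
    have hzero : f - c • LinearMap.id = 0 := by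
      rcases LinearMap.injective_or_eq_zero (f - c • LinearMap.id) with h | h
      · refine absurd (h (a₁ := x) (a₂ := 0) ?_) hx.2
        have := hx.apply_eq_smul
        simpa [sub_eq_zero] using this
      · exact h
    exact sub_eq_zero.mp (LinearMap.congr_fun hzero y)
  have hoff (i j : Fin r) (hij : i ≠ j) (x : M i) : φ (Pi.single i x) j = 0 := by
    let f : M i →ₗ[R] M j := LinearMap.proj j ∘ₗ φ ∘ₗ LinearMap.single R M i
    rcases LinearMap.bijective_or_eq_zero f with h | h
    · exact absurd (hd i j ⟨LinearEquiv.ofBijective f h⟩) hij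
    · exact LinearMap.congr_fun h x
  choose c hc using hscal
  refine ⟨c, fun m => ?_⟩
  conv_lhs => rw [← Finset.univ_sum_single m, map_sum]
  funext j
  rw [Finset.sum_apply, Finset.sum_eq_single j]
  · exact hc j _
  · exact fun i _ h => hoff i j h _
  · simp

end SimpleModules

/-! ### The structure map of `A`: surjectivity and kernel -/

section StructureFamily

variable {k : Type u} [Field k] {r : ℕ} {ι : Type*} [Fintype ι] [DecidableEq ι]
  {A : Type v} [Ring A] [Algebra k A]
  {M : Fin r → Type v} [∀ i, AddCommGroup (M i)] [∀ i, Module k (M i)]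
  [∀ i, Module Aᵐᵒᵖ (M i)] [∀ i, IsScalarTower k Aᵐᵒᵖ (M i)]
  {t : ι → Fin r}

theorem IsSimpleSystem.finite [FiniteDimensional k A] (hM : IsSimpleSystem A M) (i : Fin r) :
    Module.Finite k (M i) := by
  have := hM.simple i
  obtain ⟨m, hm⟩ := @exists_ne _ (IsSimpleModule.nontrivial Aᵐᵒᵖ (M i)) 0
  have : Module.Finite k Aᵐᵒᵖ := Module.Finite.equiv (MulOpposite.opLinearEquiv k)
  exact Module.Finite.of_surjective
    ((LinearMap.toSpanSingleton Aᵐᵒᵖ (M i) m).restrictScalars k)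
    (IsSimpleModule.toSpanSingleton_surjective Aᵐᵒᵖ hm)

/-- The commutant of `A` on `M` consists of the scalars `k^r`, so `f` lies in the bicommutant. By
the density theorem some `a` agrees with `f` on the finitely many coordinate vectors. -/
theorem IsSimpleSystem.exists_rightMul_eq [IsAlgClosed k] [∀ i, Module.Finite k (M i)]
    (hM : IsSimpleSystem A M)
    (X : Coordinates (k := k) t M) (f : (∀ i, M i) →ₗ[Fin r → k] (∀ i, M i)) :
    ∃ a : A, rightMul M a = f := by
  have hs := hM.simple
  let F : Module.End (Module.End Aᵐᵒᵖ (∀ i, M i)) (∀ i, M i) :=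
    { toFun := f
      map_add' := map_add f
      map_smul' := fun φ m => by
        obtain ⟨c, hc⟩ := exists_smul_of_end (k := k) hM.simple hM.distinct φ
        simp [hc] }
  classical
  obtain ⟨a, ha⟩ := jacobson_density F (Finset.univ.image X.vec)
  refine ⟨a.unop, LinearMap.ext fun m => ?_⟩
  rw [← X.sum_coord_smul_vec m, map_sum, map_sum]
  refine Finset.sum_congr rfl fun α _ => ?_
  rw [map_smul, map_smul]
  congr 1
  exact (ha (X.vec α) (by simp)).symm

theorem structureFamily_unop_tmul (a : A) (m : ∀ i, M i) :
    (structureFamily (k := k) M a).unop ((1 : (base k r).carrier) ⊗ₜ m) =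
      (1 : (base k r).carrier) ⊗ₜ rightMul (k := k) M a m := rfl

theorem IsSimpleSystem.structureFamily_surjective [IsAlgClosed k] [∀ i, Module.Finite k (M i)]
    (hM : IsSimpleSystem A M) (X : Coordinates (k := k) t M) :
    Function.Surjective (structureFamily (k := k) (A := A) M) := by
  intro y
  let f : (∀ i, M i) →ₗ[Fin r → k] (∀ i, M i) :=
    { toFun := fun m => X.collapse (y.unop ((1 : (base k r).carrier) ⊗ₜ m))
      map_add' := fun m m' => by rw [TensorProduct.tmul_add, map_add, X.collapse_add]
      map_smul' := fun c m => by
        rw [← unit_smul_tmul, map_smul]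
        exact X.collapse_smul c _ }
  obtain ⟨a, ha⟩ := hM.exists_rightMul_eq X f
  refine ⟨a, MulOpposite.unop_injective (induced_hom_ext fun m => ?_)⟩
  rw [structureFamily_unop_tmul, ha]
  exact X.one_tmul_collapse _

/-- An element of the kernel annihilates every simple module, in particular every quotient by a
maximal left ideal of `Aᵐᵒᵖ`, so it lies in all these ideals. -/
theorem IsSimpleSystem.op_mem_jacobson (hM : IsSimpleSystem A M)
    (X : Coordinates (k := k) t M) {a : A} (ha : structureFamily (k := k) M a = 0) :
    MulOpposite.op a ∈ Ring.jacobson Aᵐᵒᵖ := by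
  have h0 (i : Fin r) (x : M i) : MulOpposite.op a • x = 0 := by
    have h := structureFamily_unop_tmul (k := k) a (Pi.single i x)
    rw [ha] at h
    have h2 := congrArg X.collapse h
    rw [X.collapse_one_tmul] at h2
    have h3 : X.collapse 0 = 0 := by simpa using X.collapse_one_tmul 0
    have h4 := congrFun (h3.symm.trans h2) i
    simpa [rightMul] using h4.symm
  rw [Ring.jacobson_eq_sInf_isMaximal, Submodule.mem_sInf]
  intro I hI
  have : IsSimpleModule Aᵐᵒᵖ (Aᵐᵒᵖ ⧸ I) := isSimpleModule_iff_isCoatom.mpr (Ideal.isMaximal_def.mp hI)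
  obtain ⟨i, ⟨e⟩⟩ := hM.exhaustive (Aᵐᵒᵖ ⧸ I)
  have h1 : MulOpposite.op a • (Submodule.Quotient.mk (p := I) 1) = 0 := by
    apply e.injective
    rw [map_smul, h0, map_zero]
  rwa [← Submodule.Quotient.mk_smul, Submodule.Quotient.mk_eq_zero, smul_eq_mul, mul_one] at h1

end StructureFamily

/-! ### Transport of frames and the frame of an algebra over its corner -/

section FrameConstructions

universe w₁ w₂ w₃

variable {k : Type u} [Field k] {r : ℕ} {ι : Type*} [Fintype ι] [DecidableEq ι]
  {t : ι → Fin r} {b : Fin r → ι}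

namespace Frame

variable {S : AugAlg.{u, w₁} k r} {S' : AugAlg.{u, w₂} k r} {S'' : AugAlg.{u, w₃} k r}
  {B B' B'' : Type*} [Ring B] [Algebra k B] [Ring B'] [Algebra k B'] [Ring B''] [Algebra k B'']
  {F : Frame S t b B} {G : Frame S' t b B'} {K : Frame S'' t b B''}

theorem IsOver.comp {ψ : Hom S' S''} {χ : Hom S S'} {f : B' →ₐ[k] B''} {g : B →ₐ[k] B'}
    (hf : G.IsOver K ψ f) (hg : F.IsOver G χ g) : F.IsOver K (ψ.comp χ) (f.comp g) where
  map_p α := by rw [AlgHom.comp_apply, hg.map_p, hf.map_p]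
  map_q α := by rw [AlgHom.comp_apply, hg.map_q, hf.map_q]
  map_c x := by rw [AlgHom.comp_apply, hg.map_c, hf.map_c]; rfl

/-- Transport of a frame along an isomorphism of augmented algebras. -/
noncomputable def transport (F : Frame S t b B) (ψ : Hom S S')
    (h : Function.Bijective ψ.toAlgHom) : Frame S' t b B where
  toMatrixUnits := F.toMatrixUnits
  c := F.c ∘ₗ (ψ.inverse h).toAlgHom.toLinearMap
  d := ψ.toAlgHom.toLinearMap ∘ₗ F.d
  c_mul x y := by simp [F.c_mul]
  d_c x := by
    simp only [LinearMap.comp_apply, F.d_c]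
    exact (AlgEquiv.ofBijective ψ.toAlgHom h).apply_symm_apply x
  c_d y := by
    have : (ψ.inverse h).toAlgHom (ψ.toAlgHom (F.d y)) = F.d y :=
      (AlgEquiv.ofBijective ψ.toAlgHom h).symm_apply_apply _
    simp [this, F.c_d]
  c_unit i := by simp [(ψ.inverse h).map_unit, F.c_unit]

theorem IsOver.transport {F : Frame S t b B} (ψ : Hom S S') (h : Function.Bijective ψ.toAlgHom)
    {G : Frame (AugAlg.base k r) t b B'} {f : B →ₐ[k] B'} (hf : F.IsOver G S.augHom f) :
    (F.transport ψ h).IsOver G S'.augHom f where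
  map_p α := hf.map_p α
  map_q α := hf.map_q α
  map_c x := by
    refine (hf.map_c _).trans (congrArg G.c ?_)
    exact (ψ.inverse h).map_aug x

variable (F G) in
/-- A homomorphism that preserves matrix units induces a homomorphism of the corners. -/
def cornerHom (f : B →ₐ[k] B') (hp : ∀ α, f (F.p α) = G.p α) : S.carrier →ₐ[k] S'.carrier :=
  have h1 : f (F.c 1) = G.c 1 := by simp only [c_one, map_sum, hp]
  AlgHom.ofLinearMap (G.d ∘ₗ f.toLinearMap ∘ₗ F.c)
    (by
      change G.d (f (F.c 1)) = 1
      rw [h1, G.d_c])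
    (by
      intro x y
      apply G.c_injective
      change G.c (G.d (f (F.c (x * y)))) = G.c (G.d (f (F.c x)) * G.d (f (F.c y)))
      have key (z) : G.c (G.d (f (F.c z))) = f (F.c z) := by
        rw [G.c_d, ← h1, ← map_mul f, ← map_mul f, c_one_mul, c_mul_one]
      rw [G.c_mul, key, key, key, F.c_mul, map_mul f])

theorem c_cornerHom (f : B →ₐ[k] B') (hp : ∀ α, f (F.p α) = G.p α) (x : S.carrier) :
    G.c (cornerHom F G f hp x) = f (F.c x) := by
  have h1 : f (F.c 1) = G.c 1 := by simp only [c_one, map_sum, hp]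
  change G.c (G.d (f (F.c x))) = _
  rw [G.c_d, ← h1, ← map_mul, ← map_mul, c_one_mul, c_mul_one]

theorem cornerHom_unit (f : B →ₐ[k] B') (hp : ∀ α, f (F.p α) = G.p α) (c : Fin r → k) :
    cornerHom F G f hp (S.unit c) = S'.unit c := by
  have h (i : Fin r) : cornerHom F G f hp (S.unit (Pi.single i 1)) = S'.unit (Pi.single i 1) := by
    apply G.c_injective
    rw [c_cornerHom, F.c_unit, hp, G.c_unit]
  have hc : c = ∑ i, c i • Pi.single i (1 : k) := by
    simp [← Pi.single_smul', Finset.univ_sum_single]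
  rw [hc]
  simp only [map_sum, map_smul, h]

end Frame

namespace MatrixUnits

variable {A : Type v} [Ring A] [Algebra k A] (Z : MatrixUnits t b A) (htb : ∀ i, t (b i) = i)

/-- The sum of the base idempotents. -/
def baseIdem : A := ∑ i, Z.p (b i)

include htb in
theorem base_mul_baseIdem (i : Fin r) : Z.p (b i) * Z.baseIdem = Z.p (b i) := by
  rw [baseIdem, Finset.mul_sum]
  simp [Z.base_mul_base htb]

include htb in
theorem baseIdem_mul_base (i : Fin r) : Z.baseIdem * Z.p (b i) = Z.p (b i) := by
  rw [baseIdem, Finset.sum_mul]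
  simp [Z.base_mul_base htb]

include htb in
theorem baseIdem_mul_baseIdem : Z.baseIdem * Z.baseIdem = Z.baseIdem := by
  conv_lhs => enter [2]; rw [baseIdem]
  rw [Finset.mul_sum]
  simp_rw [Z.baseIdem_mul_base htb]
  rfl

variable (k) in
/-- The corner cut out by the base idempotents. -/
def corner : NonUnitalSubalgebra k A where
  carrier := {x | Z.baseIdem * x = x ∧ x * Z.baseIdem = x}
  add_mem' := fun {x y} hx hy => ⟨by rw [mul_add, hx.1, hy.1], by rw [add_mul, hx.2, hy.2]⟩
  zero_mem' := ⟨mul_zero _, zero_mul _⟩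
  mul_mem' := fun {x y} hx hy => ⟨by rw [← mul_assoc, hx.1], by rw [mul_assoc, hy.2]⟩
  smul_mem' := fun c x hx => ⟨by rw [mul_smul_comm, hx.1], by rw [smul_mul_assoc, hx.2]⟩

/-- The corner as a unital ring. -/
abbrev cornerRing : Ring (Z.corner k) :=
  { (inferInstance : NonUnitalRing (Z.corner k)) with
    one := ⟨Z.baseIdem, Z.baseIdem_mul_baseIdem htb, Z.baseIdem_mul_baseIdem htb⟩
    one_mul := fun x => Subtype.ext x.2.1
    mul_one := fun x => Subtype.ext x.2.2 }

/-- The corner as an algebra. -/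
abbrev cornerAlgebra : letI := Z.cornerRing (k := k) htb; Algebra k (Z.corner k) :=
  letI := Z.cornerRing (k := k) htb
  Algebra.ofModule (fun c x y => Subtype.ext (smul_mul_assoc c x.1 y.1))
    (fun c x y => Subtype.ext (mul_smul_comm c x.1 y.1))

variable {C : Type*} [Ring C] [Algebra k C] (G : Frame (AugAlg.base k r) t b C) (σ : A →ₐ[k] C)
  (hp : ∀ α, σ (Z.p α) = G.p α)

include hp in
theorem map_baseIdem : σ Z.baseIdem = G.c 1 := by
  rw [Frame.c_one, baseIdem, map_sum]
  simp_rw [hp]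

include hp in
theorem c_d_map (x : Z.corner k) : G.c (G.d (σ x.1)) = σ x.1 := by
  rw [G.c_d, ← Z.map_baseIdem G σ hp, ← map_mul, ← map_mul, x.2.1, x.2.2]

/-- The corner as an augmented algebra. -/
def cornerAug : AugAlg.{u, v} k r :=
  letI := Z.cornerRing (k := k) htb
  letI := Z.cornerAlgebra (k := k) htb
  { carrier := Z.corner k
    unit := AlgHom.ofLinearMap
      { toFun := fun c => ⟨∑ i, c i • Z.p (b i), by
          constructor
          · simp_rw [Finset.mul_sum, mul_smul_comm, Z.baseIdem_mul_base htb]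
          · simp_rw [Finset.sum_mul, smul_mul_assoc, Z.base_mul_baseIdem htb]⟩
        map_add' := fun c c' => Subtype.ext (by simp [add_smul, Finset.sum_add_distrib])
        map_smul' := fun c c' => Subtype.ext (by simp [mul_smul, Finset.smul_sum]) }
      (Subtype.ext (by
        change ∑ i, (1 : Fin r → k) i • Z.p (b i) = Z.baseIdem
        simp [baseIdem]))
      (fun c c' => Subtype.ext (by
        change ∑ i, (c * c') i • Z.p (b i) = (∑ i, c i • Z.p (b i)) * ∑ i, c' i • Z.p (b i)
        simp_rw [Finset.sum_mul, Finset.mul_sum, smul_mul_smul_comm, Z.base_mul_base htb]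
        simp))
    aug := AlgHom.ofLinearMap
      -- `σ` maps the corner of `A` into the corner of `C`, which `G` identifies with `k^r`; hence
      -- `G.d` is multiplicative on these values.
      { toFun := fun x => (show Fin r → k from G.d (σ x.1))
        map_add' := fun x y => by
          change G.d (σ (x.1 + y.1)) = G.d (σ x.1) + G.d (σ y.1)
          rw [map_add, map_add]
        map_smul' := fun c x => by
          change G.d (σ (c • x.1)) = c • G.d (σ x.1)
          rw [map_smul, map_smul] }
      (by
        change G.d (σ Z.baseIdem) = 1
        rw [Z.map_baseIdem G σ hp, G.d_c])
      (fun x y => by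
        change G.d (σ (x.1 * y.1)) = G.d (σ x.1) * G.d (σ y.1)
        apply G.c_injective
        rw [G.c_mul, Z.c_d_map G σ hp x, Z.c_d_map G σ hp y]
        exact (Z.c_d_map G σ hp (x * y)).trans (map_mul σ _ _))
    aug_unit := fun c => by
      change G.d (σ (∑ i, c i • Z.p (b i))) = c
      simp only [map_sum, map_smul, hp, G.d_p]
      change ∑ i, c i • Pi.single i (1 : k) = c
      simp [← Pi.single_smul', Finset.univ_sum_single] }

/-- An algebra with matrix units has a frame over its corner. -/
def cornerFrame : Frame (Z.cornerAug htb G σ hp) t b A where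
  toMatrixUnits := Z
  c := (Z.corner k).toSubmodule.subtype
  d :=
    { toFun := fun x => ⟨Z.baseIdem * x * Z.baseIdem, by
        constructor
        · rw [← mul_assoc, ← mul_assoc, Z.baseIdem_mul_baseIdem htb]
        · rw [mul_assoc, Z.baseIdem_mul_baseIdem htb]⟩
      map_add' := fun x y => Subtype.ext (by
        simp only [mul_add, add_mul]
        rfl)
      map_smul' := fun c x => Subtype.ext (by
        simp only [mul_smul_comm, smul_mul_assoc]
        rfl) }
  c_mul _ _ := rfl
  d_c x := Subtype.ext (by
    change Z.baseIdem * x.1 * Z.baseIdem = x.1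
    rw [x.2.1, x.2.2])
  c_d _ := rfl
  c_unit i := by
    change ∑ j, (Pi.single i 1 : Fin r → k) j • Z.p (b j) = Z.p (b i)
    simp [Pi.single_apply]

theorem cornerFrame_isOver (hq : ∀ α, σ (Z.q α) = G.q α) :
    (Z.cornerFrame htb G σ hp).IsOver G (Z.cornerAug htb G σ hp).augHom σ where
  map_p := hp
  map_q := hq
  map_c x := (Z.c_d_map G σ hp x).symm

end MatrixUnits

end FrameConstructions

/-! ### Versality of the family given by a frame -/

section PreCompletion

universe w₁ w₂

variable {k : Type u} [Field k] {r : ℕ} {ι : Type*} [Fintype ι] [DecidableEq ι]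
  {t : ι → Fin r} {b : Fin r → ι} {A : Type v} [Ring A] [Algebra k A]
  {M : Fin r → Type v} [∀ i, AddCommGroup (M i)] [∀ i, Module k (M i)]

theorem MatrixUnits.map_intertwiner_eq_one {B C : Type*} [Ring B] [Algebra k B] [Ring C]
    [Algebra k C] (f : B →ₐ[k] C) {X Y : MatrixUnits t b B} (W : MatrixUnits t b C)
    (hX : ∀ α, f (X.p α) = W.p α) (hY : ∀ α, f (Y.q α) = W.q α) : f (X.intertwiner Y) = 1 := by
  rw [intertwiner, map_sum, ← W.sum_p_mul_q]
  simp_rw [map_mul, hX, hY]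

/-- Conjugation of a homomorphism by a unit. -/
def conjHom {B : Type*} [Semiring B] [Algebra k B] (g : Bˣ) (φ : A →ₐ[k] B) : A →ₐ[k] B :=
  AlgHom.ofLinearMap
    { toFun := fun a => ↑g⁻¹ * φ a * g
      map_add' := fun x y => by simp [mul_add, add_mul]
      map_smul' := fun c x => by simp }
    (by simp)
    (fun x y => by simp [mul_assoc])

theorem conjHom_apply {B : Type*} [Semiring B] [Algebra k B] (g : Bˣ) (φ : A →ₐ[k] B) (a : A) :
    conjHom g φ a = ↑g⁻¹ * φ a * g := rfl

theorem conjHom_matrixUnits {B : Type*} [Ring B] [Algebra k B] (htb : ∀ i, t (b i) = i)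
    (Z : MatrixUnits t b A) (Y : MatrixUnits t b B) (φ : A →ₐ[k] B) (g : Bˣ)
    (hg : (g : B) = (Z.map (φ : A →+* B)).intertwiner Y) :
    (∀ α, conjHom g φ (Z.p α) = Y.p α) ∧ ∀ α, conjHom g φ (Z.q α) = Y.q α := by
  have h := (Z.map (φ : A →+* B)).conj_of_intertwiner Y htb g hg
  exact ⟨fun α => (h α).1, fun α => (h α).2⟩

variable [∀ i, Module Aᵐᵒᵖ (M i)] [∀ i, IsScalarTower k Aᵐᵒᵖ (M i)]

omit [∀ i, Module Aᵐᵒᵖ (M i)] [∀ i, IsScalarTower k Aᵐᵒᵖ (M i)] in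
theorem extend_inv_eq_one {S : AugAlg.{u, w} k r} {g : (EndInduced S M)ˣ}
    (hg : AugAlg.extend M S.augHom (g : EndInduced S M) = 1) :
    AugAlg.extend M S.augHom (↑g⁻¹ : EndInduced S M) = 1 := by
  have := congrArg (AugAlg.extend M S.augHom) g.mul_inv
  rwa [map_mul, hg, one_mul, map_one] at this

omit [∀ i, Module Aᵐᵒᵖ (M i)] [∀ i, IsScalarTower k Aᵐᵒᵖ (M i)] in
theorem extend_conj {S : AugAlg.{u, w} k r} {g : (EndInduced S M)ˣ}
    (hg : AugAlg.extend M S.augHom (g : EndInduced S M) = 1) (x : EndInduced S M) :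
    AugAlg.extend M S.augHom (↑g⁻¹ * x * g) = AugAlg.extend M S.augHom x := by
  rw [map_mul, map_mul, hg, extend_inv_eq_one hg, one_mul, mul_one]

theorem IsFamily.conjHom {S : AugAlg.{u, w} k r} {φ : A →ₐ[k] EndInduced S M}
    (hφ : IsFamily S φ) {g : (EndInduced S M)ˣ}
    (hg : AugAlg.extend M S.augHom (g : EndInduced S M) = 1) : IsFamily S (conjHom g φ) :=
  AlgHom.ext fun a => (extend_conj hg (φ a)).trans (DFunLike.congr_fun hφ a)

omit [∀ i, Module Aᵐᵒᵖ (M i)] [∀ i, IsScalarTower k Aᵐᵒᵖ (M i)] in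
theorem familyEquiv_conjHom {S : AugAlg.{u, w} k r} (φ : A →ₐ[k] EndInduced S M)
    {g : (EndInduced S M)ˣ} (hg : AugAlg.extend M S.augHom (g : EndInduced S M) = 1) :
    FamilyEquiv S (LocalFunctions.conjHom g φ) φ :=
  ⟨g, hg, fun a => by rw [conjHom_apply, mul_assoc, Units.mul_inv_cancel_left]⟩

/-- Each family over a complete algebra is isomorphic to one that preserves matrix units. -/
theorem exists_conj_preserving_matrixUnits (X : Coordinates (k := k) t M)
    (htb : ∀ i, t (b i) = i) (Z : MatrixUnits t b A)
    (hp : ∀ α, structureFamily (k := k) M (Z.p α) = (X.frame htb (AugAlg.base k r)).p α)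
    {S : AugAlg.{u, w} k r} (hS : S.IsComplete) {φ : A →ₐ[k] EndInduced S M} (hφ : IsFamily S φ) :
    ∃ φ' : A →ₐ[k] EndInduced S M, IsFamily S φ' ∧ FamilyEquiv S φ' φ ∧
      (∀ α, φ' (Z.p α) = (X.frame htb S).p α) ∧ ∀ α, φ' (Z.q α) = (X.frame htb S).q α := by
  have hφa (a : A) : AugAlg.extend M S.augHom (φ a) = structureFamily M a :=
    DFunLike.congr_fun hφ a
  -- The images of `Z` under `φ` and the standard units have the same reduction, so their
  -- intertwiner reduces to `∑ p α * q α = 1`; completeness then makes it a unit.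
  have hg1 := MatrixUnits.map_intertwiner_eq_one (k := k) (B := EndInduced S M)
    (C := EndInduced (AugAlg.base k r) M) (AugAlg.extend M S.augHom)
    (X := Z.map (φ : A →+* EndInduced S M)) (Y := (X.frame htb S).toMatrixUnits)
    (X.frame htb (AugAlg.base k r)).toMatrixUnits
    (fun α => (hφa _).trans (hp α)) (X.isOver_extend htb S.augHom).map_q
  obtain ⟨g, hg⟩ := X.isUnit_of_extend_eq_one htb hS hg1
  rw [← hg] at hg1
  have hconj := conjHom_matrixUnits (B := EndInduced S M) htb Z (X.frame htb S).toMatrixUnits φ g hg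
  exact ⟨conjHom (B := EndInduced S M) g φ, hφ.conjHom hg1, familyEquiv_conjHom φ hg1, hconj⟩

variable (X : Coordinates (k := k) t M) (htb : ∀ i, t (b i) = i)
  {H : AugAlg.{u, w₁} k r} (F : Frame H t b A)

/-- The homomorphism `A → End_H (H ⊗ M)` defined by a frame of `A` over `H`. -/
noncomputable def frameFamily : A →ₐ[k] EndInduced H M := F.mapHom (X.frame htb H) (Hom.id H)

omit [∀ i, Module Aᵐᵒᵖ (M i)] [∀ i, IsScalarTower k Aᵐᵒᵖ (M i)] in
theorem frameFamily_bijective : Function.Bijective (frameFamily X htb F) :=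
  F.mapHom_bijective _ _ Function.bijective_id

omit [∀ i, Module Aᵐᵒᵖ (M i)] [∀ i, IsScalarTower k Aᵐᵒᵖ (M i)] in
theorem isOver_frameFamily : F.IsOver (X.frame htb H) (Hom.id H) (frameFamily X htb F) :=
  F.isOver_mapHom _ _

omit [∀ i, Module Aᵐᵒᵖ (M i)] [∀ i, IsScalarTower k Aᵐᵒᵖ (M i)] in
theorem isOver_extend_frameFamily {S : AugAlg.{u, w₂} k r} (ψ : Hom H S) :
    F.IsOver (X.frame htb S) ψ ((AugAlg.extend M ψ).comp (frameFamily X htb F)) :=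
  (X.isOver_extend htb ψ).comp (isOver_frameFamily X htb F)

variable {F} (hF : F.IsOver (X.frame htb (AugAlg.base k r)) H.augHom (structureFamily M))

include hF in
theorem frameFamily_isFamily : IsFamily H (frameFamily X htb F) :=
  (isOver_extend_frameFamily X htb F H.augHom).eq hF

/-- The morphism defined by a family that preserves matrix units. -/
noncomputable def Coordinates.cornerMorphism {S : AugAlg.{u, w₂} k r} {φ : A →ₐ[k] EndInduced S M}
    (hφ : IsFamily S φ) (hp : ∀ α, φ (F.p α) = (X.frame htb S).p α) : Hom H S where
  toAlgHom := Frame.cornerHom (B' := EndInduced S M) F (X.frame htb S) φ hp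
  map_unit := Frame.cornerHom_unit (B' := EndInduced S M) φ hp
  map_aug x := by
    have hφa (a : A) : AugAlg.extend M S.augHom (φ a) = structureFamily M a :=
      DFunLike.congr_fun hφ a
    apply (X.frame htb (AugAlg.base k r)).c_injective
    have h1 := (X.isOver_extend htb S.augHom).map_c
      (Frame.cornerHom (B' := EndInduced S M) F (X.frame htb S) φ hp x)
    rw [Frame.c_cornerHom (B' := EndInduced S M), hφa, hF.map_c] at h1
    exact h1.symm

include hF in
-- Once conjugated to preserve matrix units, the family restricts to a morphism `ψ` of corners. It
-- and the extension of `frameFamily` along `ψ` both lie over `ψ`, so they coincide.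
theorem frameFamily_versal {S : AugAlg.{u, w₂} k r} (hS : S.IsComplete)
    {φ : A →ₐ[k] EndInduced S M} (hφ : IsFamily S φ) :
    ∃ ψ : Hom H S, FamilyEquiv S ((AugAlg.extend M ψ).comp (frameFamily X htb F)) φ := by
  obtain ⟨φ', hφ', he, hp, hq⟩ :=
    exists_conj_preserving_matrixUnits X htb F.toMatrixUnits hF.map_p hS hφ
  have hψ := isOver_extend_frameFamily X htb F (X.cornerMorphism htb hF hφ' hp)
  refine ⟨X.cornerMorphism htb hF hφ' hp, ?_⟩
  rw [hψ.eq ⟨hp, hq, fun x => (Frame.c_cornerHom (B' := EndInduced S M) φ' hp x).symm⟩]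
  exact he

omit [∀ i, Module Aᵐᵒᵖ (M i)] [∀ i, IsScalarTower k Aᵐᵒᵖ (M i)] in
-- The corner `γ` of the conjugating unit intertwines `ψ` and `ψ'`. It has the form `1 + δ` with `δ`
-- in a square-zero ideal and turns out to be central and invertible.
theorem frameFamily_unique {S : AugAlg.{u, w₂} k r}
    (hS : ∀ x ∈ S.augIdeal, ∀ y ∈ S.augIdeal, x * y = 0) {ψ ψ' : Hom H S}
    (h : FamilyEquiv S ((AugAlg.extend M ψ).comp (frameFamily X htb F))
      ((AugAlg.extend M ψ').comp (frameFamily X htb F))) : ψ = ψ' := by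
  obtain ⟨g, hg, h⟩ := h
  set G := X.frame htb S with hG
  have hψ := isOver_extend_frameFamily X htb F ψ
  have hψ' := isOver_extend_frameFamily X htb F ψ'
  set γ : S.carrier := G.d (g : EndInduced S M) with hγ
  have hcγ : G.c γ = G.c 1 * g * G.c 1 := G.c_d _
  have haug : S.aug γ = 1 := by
    apply (X.frame htb (AugAlg.base k r)).c_injective
    have h1 := (X.isOver_extend htb S.augHom).map_c γ
    have h2 := (X.isOver_extend htb S.augHom).map_c 1
    rw [← hG, hcγ, map_mul, map_mul, hg, mul_one, ← map_mul, Frame.c_one_mul, h2] at h1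
    rw [map_one] at h1
    exact h1.symm
  have key (x : H.carrier) : ψ'.toAlgHom x * γ = γ * ψ.toAlgHom x := by
    apply G.c_injective
    have h1 := h (F.c x)
    rw [hψ.map_c, hψ'.map_c, ← hG] at h1
    rw [G.c_mul, G.c_mul, hcγ]
    calc G.c (ψ'.toAlgHom x) * (G.c 1 * g * G.c 1)
        = (G.c (ψ'.toAlgHom x) * G.c 1) * g * G.c 1 := by simp only [mul_assoc]
      _ = G.c (ψ'.toAlgHom x) * g * G.c 1 := by rw [Frame.c_mul_one]
      _ = G.c 1 * G.c (ψ'.toAlgHom x) * g * G.c 1 := by rw [Frame.c_one_mul]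
      _ = G.c 1 * (g * G.c (ψ.toAlgHom x)) * G.c 1 := by rw [← h1]; simp only [mul_assoc]
      _ = G.c 1 * g * (G.c (ψ.toAlgHom x) * G.c 1) := by simp only [mul_assoc]
      _ = G.c 1 * g * (G.c 1 * G.c (ψ.toAlgHom x)) := by
        rw [Frame.c_mul_one, Frame.c_one_mul]
      _ = _ := by simp only [mul_assoc]
  set δ := γ - 1 with hδ
  have hδm : δ ∈ S.augIdeal := by rw [mem_augIdeal, hδ, map_sub, haug, map_one, sub_self]
  have hγδ : γ = 1 + δ := by rw [hδ]; abel
  -- Both morphisms agree on the image of `k^r`, so there `key` says that `δ` commutes with scalars;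
  -- every other element differs from a scalar by one whose products with `δ` vanish.
  have hunit (c : Fin r → k) : S.unit c * δ = δ * S.unit c := by
    have := key (H.unit c)
    rw [ψ.map_unit, ψ'.map_unit] at this
    rw [hδ, mul_sub, sub_mul, this, mul_one, one_mul]
  have hcomm (s : S.carrier) : s * δ = δ * s := by
    have h1 := hS _ (sub_unit_aug_mem s) _ hδm
    have h2 := hS _ hδm _ (sub_unit_aug_mem s)
    rw [sub_mul, sub_eq_zero] at h1
    rw [mul_sub, sub_eq_zero] at h2
    rw [h1, h2, hunit]
  have hinv : γ * (1 - δ) = 1 := by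
    have h1 : (1 + δ) * (1 - δ) = 1 - δ * δ := by noncomm_ring
    rw [hγδ, h1, hS _ hδm _ hδm, sub_zero]
  refine Hom.ext (AlgHom.ext fun x => ?_)
  have h1 : ψ'.toAlgHom x * γ = ψ.toAlgHom x * γ := by
    rw [key, hγδ, add_mul, mul_add, hcomm, one_mul, mul_one]
  have h2 := congrArg (· * (1 - δ)) h1
  simpa only [mul_assoc, hinv, mul_one] using h2.symm

include hF in
theorem op_mem_pow_jacobson (hM : IsSimpleSystem A M) {n : ℕ} :
    ∀ x ∈ H.augIdeal ^ n, MulOpposite.op (F.c x) ∈ Ring.jacobson Aᵐᵒᵖ ^ n := by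
  induction n with
  | zero => simp [Submodule.pow_zero]
  | succ n ih =>
    intro x hx
    rw [Submodule.pow_succ] at hx
    refine Submodule.mul_induction_on hx (fun y hy z hz => ?_) (fun y z hy hz => ?_)
    -- Passing to the opposite ring reverses the product, so the new factor is split off on the left
    -- of the power.
    · rw [F.c_mul, MulOpposite.op_mul, Ideal.IsTwoSided.pow_succ]
      refine Ideal.mul_mem_mul (hM.op_mem_jacobson X ?_) (ih y hy)
      rw [hF.map_c]
      change (X.frame htb (AugAlg.base k r)).c (H.aug z) = 0
      rw [mem_augIdeal.mp hz]
      exact map_zero _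
    · rw [map_add, MulOpposite.op_add]
      exact add_mem hy hz

include hF in
theorem exists_augIdeal_pow_eq_bot [FiniteDimensional k A] (hM : IsSimpleSystem A M) :
    ∃ n, H.augIdeal ^ n = ⊥ := by
  have : Module.Finite k Aᵐᵒᵖ := Module.Finite.equiv (MulOpposite.opLinearEquiv k)
  have : IsArtinianRing Aᵐᵒᵖ := IsArtinianRing.of_finite k Aᵐᵒᵖ
  obtain ⟨n, hn⟩ := IsSemiprimaryRing.isNilpotent (R := Aᵐᵒᵖ)
  refine ⟨n, eq_bot_iff.mpr fun x hx => ?_⟩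
  have := op_mem_pow_jacobson X htb hF hM x hx
  rw [hn] at this
  apply F.c_injective
  rw [map_zero]
  exact MulOpposite.op_injective this

include X in
theorem nilpotent_of_structureFamily_eq_zero [FiniteDimensional k A] (hM : IsSimpleSystem A M)
    {a : A} (ha : structureFamily (k := k) M a = 0) : IsNilpotent a := by
  have : Module.Finite k Aᵐᵒᵖ := Module.Finite.equiv (MulOpposite.opLinearEquiv k)
  have : IsArtinianRing Aᵐᵒᵖ := IsArtinianRing.of_finite k Aᵐᵒᵖ
  obtain ⟨n, hn⟩ := IsSemiprimaryRing.isNilpotent (R := Aᵐᵒᵖ)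
  have hmem (m : ℕ) : MulOpposite.op a ^ m ∈ Ring.jacobson Aᵐᵒᵖ ^ m := by
    induction m with
    | zero => simp [Submodule.pow_zero]
    | succ m ih =>
      rw [pow_succ, Submodule.pow_succ]
      exact Ideal.mul_mem_mul ih (hM.op_mem_jacobson (k := k) X ha)
  have h := hmem n
  rw [hn] at h
  refine ⟨n, MulOpposite.op_injective ?_⟩
  rw [MulOpposite.op_pow]
  exact h

end PreCompletion

/-! ### Existence of the pre-completion and comparison with an arbitrary one -/

section Main

variable {k : Type u} [Field k] {r : ℕ} {A : Type v} [Ring A] [Algebra k A]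
  {M : Fin r → Type v} [∀ i, AddCommGroup (M i)] [∀ i, Module k (M i)]
  [∀ i, Module Aᵐᵒᵖ (M i)] [∀ i, IsScalarTower k Aᵐᵒᵖ (M i)]

/-- There is a pre-completion `(H, ρ)` with bijective `ρ` and nilpotent augmentation ideal, for
which extension of scalars along morphisms from `H` is faithful. -/
theorem exists_bijective_preCompletion [IsAlgClosed k] [FiniteDimensional k A]
    (hM : IsSimpleSystem A M) :
    ∃ (H : AugAlg.{u, max u v} k r) (ρ : A →ₐ[k] EndInduced H M), IsPreCompletion H ρ ∧
      Function.Bijective ρ ∧ (∃ n, H.augIdeal ^ n = ⊥) ∧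
      ∀ (S : AugAlg.{u, max u v} k r) (ψ : Hom H S), Function.Injective (AugAlg.extend M ψ) →
        Function.Injective ψ.toAlgHom := by
  have hfin := hM.finite (k := k)
  have hpos (i : Fin r) : 0 < Module.finrank k (M i) := by
    have := hM.simple i
    have := IsSimpleModule.nontrivial Aᵐᵒᵖ (M i)
    exact Module.finrank_pos
  let X := coordinatesOfFinite (k := k) M
  -- The first basis vector of each block; it exists because a simple module is nonzero.
  let b : Fin r → Σ i, Fin (Module.finrank k (M i)) := fun i => ⟨i, ⟨0, hpos i⟩⟩
  have htb (i : Fin r) : Sigma.fst (b i) = i := rfl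
  obtain ⟨Z, hp, hq⟩ := (X.frame htb (AugAlg.base k r)).toMatrixUnits.exists_lift
    (structureFamily (k := k) (A := A) M).toRingHom (hM.structureFamily_surjective X)
    (fun x hx => nilpotent_of_structureFamily_eq_zero X hM hx) htb
  let F₀ := Z.cornerFrame htb (X.frame htb (AugAlg.base k r)) (structureFamily M) hp
  -- The corner lives in the universe of `A`, whereas pre-completions are taken in `max u v`.
  let H := ulift.{u, v, u} (Z.cornerAug htb (X.frame htb (AugAlg.base k r)) (structureFamily M) hp)
  let F : Frame H _ b A :=
    F₀.transport (upHom.{u, v, u} _) (ULift.algEquiv (R := k)).symm.bijective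
  have hF : F.IsOver (X.frame htb (AugAlg.base k r)) H.augHom (structureFamily M) :=
    (Z.cornerFrame_isOver htb (X.frame htb (AugAlg.base k r)) (structureFamily M) hp hq).transport
      _ _
  obtain ⟨n, hn⟩ := exists_augIdeal_pow_eq_bot X htb hF hM
  refine ⟨H, frameFamily X htb F, ⟨isComplete_of_pow_eq_bot hn, frameFamily_isFamily X htb hF,
    fun S hS φ hφ => frameFamily_versal X htb hF hS hφ, fun S hS φ _ ψ ψ' h h' => ?_⟩,
    frameFamily_bijective X htb F, ⟨n, hn⟩, fun S ψ hψ x y hxy => ?_⟩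
  · exact frameFamily_unique X htb (fun x hx y hy => hS.mul_eq_zero hx hy) (h.trans h'.symm)
  · apply (X.frame htb H).c_injective
    apply hψ
    rw [(X.isOver_extend htb ψ).map_c, (X.isOver_extend htb ψ).map_c, hxy]

/-- An endomorphism of a pre-completion that preserves the family up to isomorphism is the
identity modulo the square of the augmentation ideal. -/
theorem IsPreCompletion.sub_mem_sq {H : AugAlg.{u, max u v} k r} {ρ : A →ₐ[k] EndInduced H M}
    (h : IsPreCompletion H ρ) (χ : Hom H H)
    (hχ : FamilyEquiv H ((AugAlg.extend M χ).comp ρ) ρ) (x : H.carrier) :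
    x - χ.toAlgHom x ∈ H.augIdeal ^ 2 := by
  refine IsComplete.mem_sq_of_forall_hom ?_ fun ψ => ?_
  · rw [mem_augIdeal, map_sub, χ.map_aug, sub_self]
  -- `ψ` and `ψ ∘ χ` induce isomorphic families over the tangent algebra, so they are equal and `ψ`
  -- kills `x - χ x`.
  · have h1 := h.unique (ulift.{u, u, v} (tangent k r)) (ulift_isIso _)
      ((AugAlg.extend M ((upHom _).comp ψ)).comp ρ) (h.isFamily.extend _)
      ((upHom _).comp ψ) (((upHom _).comp ψ).comp χ) (FamilyEquiv.refl _) (by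
        rw [extend_comp _ _ χ, AlgHom.comp_assoc]
        exact hχ.extend _)
    have h2 := congrArg (fun f => f.toAlgHom x) h1
    rw [map_sub, sub_eq_zero]
    exact upHom_injective _ h2

theorem IsPreCompletion.bijective [IsAlgClosed k] [FiniteDimensional k A]
    (hM : IsSimpleSystem A M) {H : AugAlg.{u, max u v} k r} {ρ : A →ₐ[k] EndInduced H M}
    (h : IsPreCompletion H ρ) : Function.Bijective ρ := by
  obtain ⟨H₀, ρ₀, h₀, hρ₀, ⟨n, hn⟩, hinj⟩ := exists_bijective_preCompletion (k := k) hM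
  obtain ⟨ψ₀, hψ₀⟩ := h₀.versal H h.complete ρ h.isFamily
  obtain ⟨ψ, hψ⟩ := h.versal H₀ h₀.complete ρ₀ h₀.isFamily
  have hθ : FamilyEquiv H₀ ((AugAlg.extend M (ψ.comp ψ₀)).comp ρ₀) ρ₀ := by
    rw [extend_comp, AlgHom.comp_assoc]
    exact (hψ₀.extend ψ).trans hψ
  have hχ : FamilyEquiv H ((AugAlg.extend M (ψ₀.comp ψ)).comp ρ) ρ := by
    rw [extend_comp, AlgHom.comp_assoc]
    exact (hψ.extend ψ₀).trans hψ₀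
  -- Extension along `ψ ∘ ψ₀` carries the bijective `ρ₀` to an equivalent, hence bijective, family.
  -- It is therefore injective, and so are `ψ ∘ ψ₀` and `ψ₀`.
  have hinj₀ : Function.Injective ψ₀.toAlgHom := by
    have h1 := hθ.symm.bijective_iff hρ₀
    have h2 : Function.Injective (AugAlg.extend M (ψ.comp ψ₀)) := by
      intro x y hxy
      obtain ⟨a, rfl⟩ := hρ₀.2 x
      obtain ⟨c, rfl⟩ := hρ₀.2 y
      rw [h1.1 hxy]
    exact Function.Injective.of_comp (f := ψ.toAlgHom) (hinj _ _ h2)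
  -- Modulo the square of the augmentation ideal, `ψ x` is a preimage of `x` under `ψ₀`.
  have hsurj₀ : Function.Surjective ψ₀.toAlgHom :=
    ψ₀.surjective_of_nilpotent hn h.complete fun x hx =>
      ⟨ψ.toAlgHom x, by rw [mem_augIdeal, ψ.map_aug]; exact hx, h.sub_mem_sq _ hχ x⟩
  refine hψ₀.bijective_iff ?_
  exact (extend_bijective M ψ₀ ⟨hinj₀, hsurj₀⟩).comp hρ₀

omit [∀ i, Module Aᵐᵒᵖ (M i)] [∀ i, IsScalarTower k Aᵐᵒᵖ (M i)] in
-- `ρ` already fills the whole endomorphism algebra, so adjoining scalars and inverses adds nothing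
-- to its image.
theorem eta_bijective {H : AugAlg.{u, w} k r} {ρ : A →ₐ[k] EndInduced H M}
    (h : Function.Bijective ρ) : Function.Bijective (eta ρ) := by
  refine ⟨fun x y hxy => h.1 (congrArg Subtype.val hxy), fun y => ?_⟩
  obtain ⟨a, ha⟩ := h.2 y.1
  exact ⟨a, Subtype.ext ha⟩

end Main

end LocalFunctions

theorem mainTheorem2 {k : Type u} [Field k] [IsAlgClosed k] {A : Type v} [Ring A] [Algebra k A]
    [FiniteDimensional k A] :
    (∃ (r : ℕ) (M : Fin r → Type v) (_ : ∀ i, AddCommGroup (M i)) (_ : ∀ i, Module Aᵐᵒᵖ (M i)),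
      LocalFunctions.IsSimpleSystem A M) ∧
    ∀ (r : ℕ) (M : Fin r → Type v) [∀ i, AddCommGroup (M i)] [∀ i, Module k (M i)]
      [∀ i, Module Aᵐᵒᵖ (M i)] [∀ i, IsScalarTower k Aᵐᵒᵖ (M i)],
      LocalFunctions.IsSimpleSystem A M →
        (∃ (H : LocalFunctions.AugAlg.{u, max u v} k r) (ρ : A →ₐ[k] LocalFunctions.EndInduced H M),
          LocalFunctions.IsPreCompletion H ρ) ∧
        ∀ (H : LocalFunctions.AugAlg.{u, max u v} k r) (ρ : A →ₐ[k] LocalFunctions.EndInduced H M),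
          LocalFunctions.IsPreCompletion H ρ → Function.Bijective (LocalFunctions.eta ρ) := by
  refine ⟨?_, fun r M _ _ _ _ hM => ⟨?_, fun H ρ h => ?_⟩⟩
  · have : Module.Finite k Aᵐᵒᵖ := Module.Finite.equiv (MulOpposite.opLinearEquiv k)
    have : IsArtinianRing Aᵐᵒᵖ := IsArtinianRing.of_finite k Aᵐᵒᵖ
    obtain ⟨r, M, i₁, i₂, h₁, h₂, h₃⟩ := LocalFunctions.exists_simple_modules Aᵐᵒᵖ
    exact ⟨r, M, i₁, i₂, h₁, h₂, h₃⟩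
  · obtain ⟨H, ρ, h, -⟩ := LocalFunctions.exists_bijective_preCompletion (k := k) hM
    exact ⟨H, ρ, h⟩
  · exact LocalFunctions.eta_bijective (h.bijective hM)
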